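/- Let $N\ge 0$ and let $\mathcal H=(\mathbb C^2)^{\otimes N}$. Let $|0\rangle,|1\rangle$ be the standard basis of $\mathbb C^2$, $\sigma_1,\sigma_2,\sigma_3$ the Pauli matrices (so $\sigma_3|0\rangle=|0\rangle$, $\sigma_3|1\rangle=-|1\rangle$), $V(p)$, $p\in S_N$, the unitary operator on $\mathcal H$ that permutes the tensor factors according to $p$, and $J_-=\sum_{n=1}^N\sigma_{-;n}$ with $\sigma_-=(\sigma_1-i\sigma_2)/2$. *Spin basis.* Let $j$ run through $N/2,N/2-1,\dots,j_{\min}\in\{0,\tfrac12\}$. Put $|j,j,1\rangle_0=|0\rangle^{\otimes 2j}\otimes|\psi^-\rangle^{\otimes (N/2-j)}$ with $|\psi^-\rangle=(|01\rangle-|10\rangle)/\sqrt2$, and let $\mathcal K_j$ be the linear span of the vectors $V(p)|j,j,1\rangle_0$, $p\in S_N$. Choose any orthonormal basis $(|j,j,\alpha\rangle)_\alpha$ of $\mathcal K_j$, and for $m=j,j-1,\dots,-j$ let $|j,m,\alpha\rangle$ be the vector $J_-^{\,j-m}|j,j,\alpha\rangle$ normalized by a positive factor. Let $\mathcal H_j=\mathbb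 C^{2j+1}$ have the orthonormal basis $|j,m\rangle$, $m=j,\dots,-j$, and let $S_{1,j},S_{2,j},S_{3,j}$ be the usual spin-$j$ operators on it: $S_{3,j}|j,m\rangle=m|j,m\rangle$, $S_{1,j}=(S_++S_-)/2$, $S_{2,j}=(S_+-S_-)/(2i)$, where $S_-|j,m\rangle=\sqrt{j(j+1)-m(m-1)}\,|j,m-1\rangle$ and $S_+=S_-^\dagger$. *Measurements.* For a unit vector $\hat a\in\mathbb R^3$ let $|0\rangle_a,|1\rangle_a$ be unit eigenvectors of $\hat a\cdot\vec\sigma$ for the eigenvalues $1,-1$. For $k=0,\dots,N$ let $$M_k^a=\sum_{p'}V(p')\,\big(|0\rangle_a\langle 0|^{\otimes k}\otimes|1\rangle_a\langle 1|^{\otimes (N-k)}\big)\,V(p')^\dagger ,$$ the sum being over permutations that give distinct terms. **Proposition (Measurement operators).** The vectors $|j,m,\alpha\rangle$ form an orthonormal basis of $\mathcal H$, and $\mathcal K_j\ne0$ for every $j$. Hence $|j,m,\alpha\rangle=|j,m\rangle\otimes|\alpha\rangle$ identifies $\mathcal H$ with $\bigoplus_j\mathcal H_j\otimes\mathcal K_j$.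 With respect to this decomposition: 1. For $t\in\mathbb R^3$ and $U=\exp(-i\sum_l t_l\sigma_l/2)$ one has $U^{\otimes N}=\bigoplus_j W_j(U)\otimes\mathbb 1$ with the unitary matrices $W_j(U)=\exp(-i\sum_l t_lS_{l,j})$. 2. For the standard basis setting, $M_k^{e_3}=\bigoplus_j M_{k,j}^{e_3}\otimes\mathbb 1$, where $M_{k,j}^{e_3}=|j,k-N/2\rangle\langle j,k-N/2|$ if $-j\le k-N/2\le j$, and $M_{k,j}^{e_3}=0$ otherwise. 3. For every unit vector $\hat a\in\mathbb R^3$ there is $t\in\mathbb R^3$ such that $U_a=\exp(-i\sum_l t_l\sigma_l/2)$ satisfies $\hat a\cdot\vec\sigma=U_a\sigma_3U_a^\dagger$; and for every such $t$ and every $k$, $$M_k^a=\bigoplus_j M_{k,j}^a\otimes\mathbb 1,\qquad M_{k,j}^a=W_j(U_a)\,M_{k,j}^{e_3}\,W_j(U_a)^\dagger .$$ -/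

import Mathlib

open scoped Matrix Kronecker

noncomputable section

/-! ### One qubit -/

/-- The Pauli matrices `σ_x, σ_y, σ_z` (indexed by `0, 1, 2`), in the basis `|0⟩, |1⟩`. -/
def pauli : Fin 3 → Matrix (Fin 2) (Fin 2) ℂ :=
  ![!![0, 1; 1, 0], !![0, -Complex.I; Complex.I, 0], !![1, 0; 0, -1]]

/-- The lowering matrix `σ_- = (σ_x - i σ_y) / 2`. -/
def sigmaMinus : Matrix (Fin 2) (Fin 2) ℂ :=
  (1 / 2 : ℂ) • (pauli 0 - Complex.I • pauli 1)

/-- `a · σ = ∑ l, a_l σ_l`. -/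
def pauliDot (a : EuclideanSpace ℝ (Fin 3)) : Matrix (Fin 2) (Fin 2) ℂ :=
  ∑ l, (a l : ℂ) • pauli l

/-- `U = exp(-i ∑ l, t_l σ_l / 2)`. -/
def qubitRotation (t : Fin 3 → ℝ) : Matrix (Fin 2) (Fin 2) ℂ :=
  NormedSpace.exp ((-Complex.I) • ∑ l, ((t l : ℂ) / 2) • pauli l)

/-- `ket 0, ket 1` are normalized eigenvectors `|0⟩_a, |1⟩_a` of `a · σ`, for the
eigenvalues `1` and `-1` respectively. -/
def IsLocalBasis (a : EuclideanSpace ℝ (Fin 3)) (ket : Fin 2 → Fin 2 → ℂ) : Prop :=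
  ∀ i : Fin 2, star (ket i) ⬝ᵥ ket i = 1 ∧
    pauliDot a *ᵥ ket i = (-1 : ℂ) ^ (i : ℕ) • ket i

/-! ### `N` qubits

The space `(ℂ²)^{⊗ N}` is the Hilbert space with orthonormal basis `|x_1, …, x_N⟩`,
`x : Fin N → Fin 2`. -/

/-- The `N`-qubit Hilbert space. -/
abbrev Qubits (N : ℕ) : Type := EuclideanSpace ℂ (Fin N → Fin 2)

/-- Operators on `N` qubits, as matrices in the product basis. -/
abbrev QubitOp (N : ℕ) : Type := Matrix (Fin N → Fin 2) (Fin N → Fin 2) ℂ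

/-- The tensor product `A_1 ⊗ ⋯ ⊗ A_N`. -/
def tensorOp {N : ℕ} (A : Fin N → Matrix (Fin 2) (Fin 2) ℂ) : QubitOp N :=
  Matrix.of fun x y => ∏ n, A n (x n) (y n)

/-- `V(p) |y_1, …, y_N⟩ = |y_{p⁻¹(1)}, …, y_{p⁻¹(N)}⟩`. -/
def permOp {N : ℕ} (p : Equiv.Perm (Fin N)) : QubitOp N :=
  Matrix.of fun x y => if x = y ∘ p.symm then 1 else 0

open Classical in
/-- The coarse-grained measurement operator: the sum of the distinct operators among
`V(p) (|0⟩_a⟨0|^{⊗ k} ⊗ |1⟩_a⟨1|^{⊗ (N - k)}) V(p)†`, where `p` runs through the permutations. -/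
def measOp (N k : ℕ) (ket : Fin 2 → Fin 2 → ℂ) : QubitOp N :=
  ∑ T ∈ Finset.univ.image (fun p : Equiv.Perm (Fin N) =>
      permOp p *
        tensorOp (fun n : Fin N =>
          if (n : ℕ) < k then Matrix.vecMulVec (ket 0) (star (ket 0))
          else Matrix.vecMulVec (ket 1) (star (ket 1))) *
        (permOp p)ᴴ), T

/-- The collective lowering operator `J_- = ∑ n, σ_{-;n}`. -/
def collectiveLowering (N : ℕ) : QubitOp N :=
  ∑ n : Fin N, tensorOp (fun i => if i = n then sigmaMinus else 1)

/-! ### The spin basis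

The spins `j = N/2, N/2 - 1, …, j_min` are indexed by `s : Fin (N / 2 + 1)`, the number of
singlets: `j = N/2 - s`, that is `2 j = N - 2 s`. -/

/-- `2 j`, for `j = N/2 - s`. -/
abbrev twoJ (N : ℕ) (s : Fin (N / 2 + 1)) : ℕ := N - 2 * (s : ℕ)

/-- The amplitudes of the singlet `|ψ⁻⟩ = (|01⟩ - |10⟩) / √2`. -/
def singlet (x y : Fin 2) : ℂ :=
  if x = 0 ∧ y = 1 then ((1 / Real.sqrt 2 : ℝ) : ℂ)
  else if x = 1 ∧ y = 0 then (-(1 / Real.sqrt 2 : ℝ) : ℂ)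
  else 0

/-- `|j, j, 1⟩ = |0⟩^{⊗ 2j} ⊗ |ψ⁻⟩^{⊗ s}`, where `2 j + 2 s = N`. -/
def referenceState (N : ℕ) (s : Fin (N / 2 + 1)) : Qubits N :=
  WithLp.toLp 2 fun x =>
    (∏ n : Fin (twoJ N s), if x ⟨n, lt_of_lt_of_le n.2 (Nat.sub_le _ _)⟩ = 0 then (1 : ℂ) else 0) *
    ∏ i : Fin (s : ℕ),
      singlet (x ⟨twoJ N s + 2 * i, by have := i.2; have := s.2; simp only [twoJ]; omega⟩)
        (x ⟨twoJ N s + 2 * i + 1, by have := i.2; have := s.2; simp only [twoJ]; omega⟩)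

/-- The multiplicity space `K_j`, realized as the space of the vectors of the form
`∑ p, c_p V(p) |j, j, 1⟩`. -/
def multSpace (N : ℕ) (s : Fin (N / 2 + 1)) : Submodule ℂ (Qubits N) :=
  Submodule.span ℂ (Set.range fun p : Equiv.Perm (Fin N) =>
    Matrix.toEuclideanLin (permOp p) (referenceState N s))

/-- The normalized vector `𝒩 J_-^r v`, with `𝒩 > 0`. For `v = |j, j, α⟩` this is
`|j, j - r, α⟩`. -/
def lowered {N : ℕ} (v : Qubits N) (r : ℕ) : Qubits N :=
  ((‖Matrix.toEuclideanLin (collectiveLowering N ^ r) v‖⁻¹ : ℝ) : ℂ) •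
    Matrix.toEuclideanLin (collectiveLowering N ^ r) v

/-- The index set of the spin basis: triples of `s` (for `j = N/2 - s`), `r` (for `m = j - r`,
`0 ≤ r ≤ 2 j`) and `α`. -/
abbrev SpinIndex (N : ℕ) (κ : Fin (N / 2 + 1) → Type*) : Type _ :=
  Σ s : Fin (N / 2 + 1), Fin (twoJ N s + 1) × κ s

/-- `T = ⨁_j A_j ⊗ 1` with respect to the basis `B` of vectors `|j, m⟩ ⊗ |α⟩`. -/
def HasBlocks {N : ℕ} {κ : Fin (N / 2 + 1) → Type*} [∀ s, Fintype (κ s)]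
    [∀ s, DecidableEq (κ s)] (B : OrthonormalBasis (SpinIndex N κ) ℂ (Qubits N))
    (T : QubitOp N)
    (A : ∀ s : Fin (N / 2 + 1), Matrix (Fin (twoJ N s + 1)) (Fin (twoJ N s + 1)) ℂ) : Prop :=
  LinearMap.toMatrix B.toBasis B.toBasis (Matrix.toEuclideanLin T) =
    Matrix.blockDiagonal' fun s => A s ⊗ₖ (1 : Matrix (κ s) (κ s) ℂ)

/-! ### Spin operators in dimension `2 j + 1`

With `d = 2 j`, the basis vector with index `r : Fin (d + 1)` is `|j, m⟩` for `m = j - r`. -/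

/-- `S_-`, with `S_- |j, m⟩ = √(j (j + 1) - m (m - 1)) |j, m - 1⟩`. -/
def spinLowering (d : ℕ) : Matrix (Fin (d + 1)) (Fin (d + 1)) ℂ :=
  Matrix.of fun q r =>
    let j : ℝ := d / 2
    let m : ℝ := j - (r : ℕ)
    if (q : ℕ) = r + 1 then (Real.sqrt (j * (j + 1) - m * (m - 1)) : ℂ) else 0

/-- The spin operators `S_x = (S_+ + S_-)/2`, `S_y = (S_+ - S_-)/(2i)` and
`S_z = ∑ m, m |j, m⟩⟨j, m|`, where `S_+ = S_-†` and `j = d/2`. -/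
def spinOp (d : ℕ) : Fin 3 → Matrix (Fin (d + 1)) (Fin (d + 1)) ℂ :=
  ![(1 / 2 : ℂ) • ((spinLowering d)ᴴ + spinLowering d),
    (1 / (2 * Complex.I) : ℂ) • ((spinLowering d)ᴴ - spinLowering d),
    Matrix.diagonal fun r => (d : ℂ) / 2 - (r : ℕ)]

/-- `W_j = exp(-i ∑ l, t_l S_{l,j})`, with `d = 2 j`. -/
def spinRotation (d : ℕ) (t : Fin 3 → ℝ) : Matrix (Fin (d + 1)) (Fin (d + 1)) ℂ :=
  NormedSpace.exp ((-Complex.I) • ∑ l, (t l : ℂ) • spinOp d l)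

/-- The vector `|j, m⟩`, with `d = 2 j`. -/
def spinKet (d : ℕ) (m : ℚ) : Fin (d + 1) → ℂ :=
  fun r => if (d : ℚ) / 2 - (r : ℕ) = m then 1 else 0

/-- `|j, m⟩⟨j, m|` if `-j ≤ m ≤ j`, and zero otherwise, for `m = k - N/2` and `d = 2 j`. -/
def standardBlock (N k d : ℕ) : Matrix (Fin (d + 1)) (Fin (d + 1)) ℂ :=
  let m : ℚ := (k : ℚ) - (N : ℚ) / 2
  if -((d : ℚ) / 2) ≤ m ∧ m ≤ (d : ℚ) / 2 then
    Matrix.vecMulVec (spinKet d m) (star (spinKet d m))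
  else 0

end

/-! The collective operators J_-, J_+ and 2 J_3 satisfy the sl(2) relations and J_+ is the adjoint
of J_-. A singlet is annihilated by J_+ and has weight 0, so all of `multSpace N s` consists of
highest weight vectors of weight 2j = N - 2s. Ladder algebra alone then gives the norms of the
lowered vectors and their orthogonality (`inner_lower_pow`, `orthonormal_lowered`).

Completeness is the hard part, and it is proved without dimension counts or representation theory of
the symmetric group. Let w be orthogonal to all lowered vectors. Its component with k qubits in |1⟩
is still orthogonal to them, and so is J_+ w, which lies one level lower; by induction on k, J_+ w =
0. If 2k > N, positivity of ‖J_- w‖² forces w = 0. Otherwise w is a highest weight vector orthogonal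
to every permuted reference state, and `apply_pairConfig_eq_zero` applies: after averaging over the
stabilizer of one configuration x₀, the equations J_+ g = 0 force the amplitudes of g to be g(x₀)
times numbers with the same sign pattern as the reference state. No cancellation can occur in the
overlap, so its vanishing gives g(x₀) = 0. Permuting the qubits yields w = 0.

In this basis J_- has the matrix of S_-, and adjoints and weights give the other spin operators
(`hasBlocks_spinOp`). Exponentiating gives the blocks of U^{⊗N}, since the exponential of a sum of
one-qubit operators factorizes (`exp_collective`). The standard measurement operator projects onto
the product states with N - k ones, hence is diagonal in the spin basis. A general setting is
conjugate to it by U^{⊗N}, where a half turn about the bisector of a and e₃ supplies one possible U.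
-/

noncomputable section

/-! ### Ladder operators -/

section Ladder

variable {E : Type*} [AddCommGroup E] [Module ℂ E] {e f h : Module.End ℂ E} {d : ℂ} {v : E}

theorem weight_pow_lowering (hf : ∀ u, h (f u) = f (h u) - (2 : ℂ) • f u) (hv : h v = d • v)
    (r : ℕ) : h ((f ^ r) v) = (d - 2 * r) • (f ^ r) v := by
  induction r with
  | zero => simp [hv]
  | succ r ih =>
    rw [pow_succ', Module.End.mul_apply, hf, ih, map_smul, ← sub_smul]
    congr 1
    push_cast
    ring

/-- Moving `e` past the lowering operators collects the weights d + (d - 2) + ⋯ + (d - 2r) = (r +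
1)(d - r). -/
theorem raising_pow_lowering (hef : ∀ u, e (f u) = f (e u) + h u)
    (hf : ∀ u, h (f u) = f (h u) - (2 : ℂ) • f u) (hv : h v = d • v) (he : e v = 0) (r : ℕ) :
    e ((f ^ (r + 1)) v) = ((r + 1) * (d - r)) • (f ^ r) v := by
  induction r with
  | zero => simp [hef, he, hv]
  | succ r ih =>
    rw [pow_succ', Module.End.mul_apply, hef, ih, map_smul, ← Module.End.mul_apply f,
      ← pow_succ', weight_pow_lowering hf hv, ← add_smul]
    congr 1
    push_cast
    ring

theorem raising_pow_pow_lowering (hef : ∀ u, e (f u) = f (e u) + h u)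
    (hf : ∀ u, h (f u) = f (h u) - (2 : ℂ) • f u) (hv : h v = d • v) (he : e v = 0) (r : ℕ) :
    (e ^ r) ((f ^ r) v) = (∏ i ∈ Finset.range r, ((i + 1) * (d - i))) • v := by
  induction r with
  | zero => simp
  | succ r ih =>
    rw [pow_succ, Module.End.mul_apply, raising_pow_lowering hef hf hv he, map_smul, ih, smul_smul,
      Finset.prod_range_succ, mul_comm]

theorem raising_pow_pow_lowering_eq_zero (hef : ∀ u, e (f u) = f (e u) + h u)
    (hf : ∀ u, h (f u) = f (h u) - (2 : ℂ) • f u) (hv : h v = d • v) (he : e v = 0) {r q : ℕ}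
    (hrq : r < q) : (e ^ q) ((f ^ r) v) = 0 := by
  obtain ⟨c, rfl⟩ := Nat.exists_eq_add_of_lt hrq
  rw [show r + c + 1 = (c + 1) + r by ring, pow_add, Module.End.mul_apply,
    raising_pow_pow_lowering hef hf hv he, map_smul, pow_succ, Module.End.mul_apply, he, map_zero,
    smul_zero]

end Ladder

/-! ### Tensor products of one-qubit operators -/

theorem tensorOp_mul {N : ℕ} (A B : Fin N → Matrix (Fin 2) (Fin 2) ℂ) :
    tensorOp A * tensorOp B = tensorOp fun n => A n * B n := by
  ext x y
  simp only [tensorOp, Matrix.mul_apply, Matrix.of_apply, Finset.prod_univ_sum,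
    Fintype.piFinset_univ, Finset.prod_mul_distrib]

theorem tensorOp_one {N : ℕ} : tensorOp (fun _ : Fin N => 1) = 1 := by
  ext x y
  simp only [tensorOp, Matrix.of_apply, Matrix.one_apply, Finset.prod_ite_zero,
    Finset.prod_const_one, Finset.mem_univ, true_implies, funext_iff]

theorem tensorOp_conjTranspose {N : ℕ} (A : Fin N → Matrix (Fin 2) (Fin 2) ℂ) :
    (tensorOp A)ᴴ = tensorOp fun n => (A n)ᴴ := by
  ext x y
  simp [tensorOp, Matrix.conjTranspose_apply]

/-- The operator `A` acting on the `n`-th qubit. -/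
def siteOp {N : ℕ} (n : Fin N) (A : Matrix (Fin 2) (Fin 2) ℂ) : QubitOp N :=
  tensorOp fun i => if i = n then A else 1

theorem siteOp_apply {N : ℕ} (n : Fin N) (A : Matrix (Fin 2) (Fin 2) ℂ) (x y : Fin N → Fin 2) :
    siteOp n A x y = if ∀ i, i ≠ n → x i = y i then A (x n) (y n) else 0 := by
  simp only [siteOp, tensorOp, Matrix.of_apply]
  rw [← Finset.mul_prod_erase _ _ (Finset.mem_univ n), if_pos rfl]
  have : ∏ i ∈ Finset.univ.erase n, (if i = n then A else 1) (x i) (y i) =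
      ∏ i ∈ Finset.univ.erase n, if x i = y i then (1 : ℂ) else 0 := by
    refine Finset.prod_congr rfl fun i hi => ?_
    rw [if_neg (Finset.ne_of_mem_erase hi), Matrix.one_apply]
  rw [this, Finset.prod_ite_zero]
  simp

/-- `siteOp` as a homomorphism of algebras. -/
def siteHom {N : ℕ} (n : Fin N) : Matrix (Fin 2) (Fin 2) ℂ →ₐ[ℂ] QubitOp N :=
  AlgHom.ofLinearMap
    { toFun := siteOp n
      map_add' := fun A B => by
        ext x y
        simp only [siteOp_apply, Matrix.add_apply]
        split_ifs <;> simp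
      map_smul' := fun c A => by
        ext x y
        simp only [siteOp_apply, Matrix.smul_apply]
        split_ifs <;> simp }
    (by
      change tensorOp _ = 1
      simp only [ite_self]
      exact tensorOp_one)
    (fun A B => by
      change tensorOp _ = tensorOp _ * tensorOp _
      rw [tensorOp_mul]
      congr 1
      funext i
      split_ifs <;> simp)

theorem siteHom_apply {N : ℕ} (n : Fin N) (A : Matrix (Fin 2) (Fin 2) ℂ) :
    siteHom n A = siteOp n A := rfl

theorem siteOp_commute {N : ℕ} {n m : Fin N} (h : n ≠ m) (A B : Matrix (Fin 2) (Fin 2) ℂ) :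
    Commute (siteOp n A) (siteOp m B) := by
  simp only [Commute, SemiconjBy, siteOp, tensorOp_mul]
  congr 1
  funext i
  split_ifs with h1 h2 <;> simp_all

theorem siteOp_mulVec {N : ℕ} (n : Fin N) (A : Matrix (Fin 2) (Fin 2) ℂ)
    (u : (Fin N → Fin 2) → ℂ) (x : Fin N → Fin 2) :
    (siteOp n A *ᵥ u) x = ∑ b, A (x n) b * u (Function.update x n b) := by
  have key : ∀ y, siteOp n A x y =
      ∑ b, if y = Function.update x n b then A (x n) b else 0 := by
    intro y
    rw [siteOp_apply]
    split_ifs with h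
    · rw [Finset.sum_eq_single (y n)]
      · rw [if_pos]
        funext i
        by_cases hi : i = n
        · subst hi; simp
        · simp [hi, h i hi]
      · intro b _ hb
        rw [if_neg]
        rintro rfl
        simp at hb
      · simp
    · refine (Finset.sum_eq_zero fun b _ => if_neg ?_).symm
      rintro rfl
      exact h fun i hi => by simp [hi]
  simp only [Matrix.mulVec, dotProduct, key, Finset.sum_mul, ite_mul, zero_mul]
  rw [Finset.sum_comm]
  simp

/-- The sum `∑ n, A_n` of the copies of a one-qubit operator. -/
def collective (N : ℕ) : Matrix (Fin 2) (Fin 2) ℂ →ₗ[ℂ] QubitOp N :=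
  ∑ n, (siteHom n).toLinearMap

theorem collective_apply (N : ℕ) (A : Matrix (Fin 2) (Fin 2) ℂ) :
    collective N A = ∑ n, siteOp n A := by
  simp [collective, siteHom_apply]

theorem collectiveLowering_eq (N : ℕ) : collectiveLowering N = collective N sigmaMinus := by
  rw [collective_apply]; rfl

theorem collective_mulVec {N : ℕ} (A : Matrix (Fin 2) (Fin 2) ℂ)
    (u : (Fin N → Fin 2) → ℂ) (x : Fin N → Fin 2) :
    (collective N A *ᵥ u) x = ∑ n, ∑ b, A (x n) b * u (Function.update x n b) := by
  rw [collective_apply, Matrix.sum_mulVec, Finset.sum_apply]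
  exact Finset.sum_congr rfl fun n _ => siteOp_mulVec n A u x

theorem collective_conjTranspose {N : ℕ} (A : Matrix (Fin 2) (Fin 2) ℂ) :
    (collective N A)ᴴ = collective N Aᴴ := by
  rw [collective_apply, collective_apply, Matrix.conjTranspose_sum]
  refine Finset.sum_congr rfl fun n _ => ?_
  rw [siteOp, siteOp, tensorOp_conjTranspose]
  congr 1
  funext i
  split_ifs <;> simp

/-- Operators on different qubits commute, so only the diagonal terms of the double sum survive. All
collective sl(2) relations thereby reduce to 2 × 2 matrix identities. -/
theorem collective_commutator {N : ℕ} (A B : Matrix (Fin 2) (Fin 2) ℂ) :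
    collective N A * collective N B =
      collective N B * collective N A + collective N (A * B - B * A) := by
  rw [← sub_eq_iff_eq_add']
  simp only [collective_apply, Finset.sum_mul_sum]
  rw [Finset.sum_comm (f := fun i j => siteOp i B * siteOp j A), ← Finset.sum_sub_distrib]
  refine Finset.sum_congr rfl fun n _ => ?_
  rw [← Finset.sum_sub_distrib, Finset.sum_eq_single n]
  · simp only [← siteHom_apply, map_sub, map_mul]
  · intro m _ hm
    rw [(siteOp_commute hm.symm A B).eq, sub_self]
  · simp

theorem continuous_linearMap_matrix {m n : Type*} [Fintype m] [Fintype n]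
    (F : Matrix m m ℂ →ₗ[ℂ] Matrix n n ℂ) : Continuous F := by
  exact F.continuous_of_finiteDimensional

-- Algebra homomorphisms in finite dimension are continuous, hence pass through the exponential
-- series.
open scoped Matrix.Norms.Operator in
theorem Matrix.map_exp_algHom {m n : Type*} [Fintype m] [DecidableEq m] [Fintype n] [DecidableEq n]
    (F : Matrix m m ℂ →ₐ[ℂ] Matrix n n ℂ) (A : Matrix m m ℂ) :
    F (NormedSpace.exp A) = NormedSpace.exp (F A) :=
  NormedSpace.map_exp F (continuous_linearMap_matrix F.toLinearMap) A

theorem exp_collective {N : ℕ} (A : Matrix (Fin 2) (Fin 2) ℂ) :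
    NormedSpace.exp (collective N A) = tensorOp fun _ => NormedSpace.exp A := by
  have key : ∀ S : Finset (Fin N), NormedSpace.exp (∑ n ∈ S, siteOp n A) =
      tensorOp fun i => if i ∈ S then NormedSpace.exp A else 1 := by
    intro S
    induction S using Finset.induction_on with
    | empty => simp [tensorOp_one]
    | insert n S hn ih =>
      rw [Finset.sum_insert hn, Matrix.exp_add_of_commute, ih, ← siteHom_apply,
        ← Matrix.map_exp_algHom, siteHom_apply, siteOp, tensorOp_mul]
      · congr 1
        funext i
        by_cases hi : i = n
        · subst hi; simp [hn]
        · simp [hi]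
      · refine Commute.sum_right _ _ _ fun m hm => siteOp_commute ?_ _ _
        rintro rfl
        exact hn hm
  rw [collective_apply, key]
  simp

/-! ### Permutations of the qubits -/

theorem permOp_mulVec {N : ℕ} (p : Equiv.Perm (Fin N)) (u : (Fin N → Fin 2) → ℂ)
    (x : Fin N → Fin 2) : (permOp p *ᵥ u) x = u (x ∘ p) := by
  simp only [permOp, Matrix.mulVec, dotProduct, Matrix.of_apply, ite_mul, one_mul, zero_mul]
  rw [Finset.sum_eq_single (x ∘ p)]
  · rw [if_pos]
    funext i
    simp
  · intro y _ hy
    rw [if_neg]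
    rintro rfl
    apply hy
    funext i
    simp
  · simp

theorem collective_mulVec_permOp {N : ℕ} (p : Equiv.Perm (Fin N)) (A : Matrix (Fin 2) (Fin 2) ℂ)
    (u : (Fin N → Fin 2) → ℂ) :
    collective N A *ᵥ (permOp p *ᵥ u) = permOp p *ᵥ (collective N A *ᵥ u) := by
  funext x
  simp only [permOp_mulVec, collective_mulVec]
  rw [← Equiv.sum_comp p]
  refine Finset.sum_congr rfl fun n _ => Finset.sum_congr rfl fun b _ => ?_
  rw [Function.update_comp_eq_of_injective _ p.injective]
  rfl

theorem permOp_mul_tensorOp {N : ℕ} (p : Equiv.Perm (Fin N))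
    (A : Fin N → Matrix (Fin 2) (Fin 2) ℂ) :
    permOp p * tensorOp A * (permOp p)ᴴ = tensorOp (A ∘ p.symm) := by
  have key : ∀ (M : QubitOp N) x y, (permOp p * M * (permOp p)ᴴ) x y = M (x ∘ p) (y ∘ p) := by
    intro M x y
    have h1 : ∀ (M : QubitOp N) x y, (permOp p * M) x y = M (x ∘ p) y := fun M x y =>
      permOp_mulVec p (fun z => M z y) x
    -- Taking adjoints twice turns right multiplication by V(p)† into left multiplication by V(p).
    have h2 : permOp p * M * (permOp p)ᴴ = (permOp p * (permOp p * M)ᴴ)ᴴ := by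
      simp [Matrix.conjTranspose_mul]
    rw [h2, Matrix.conjTranspose_apply, h1, Matrix.conjTranspose_apply, h1, star_star]
  ext x y
  rw [key]
  simp only [tensorOp, Matrix.of_apply]
  rw [← Equiv.prod_comp p.symm]
  simp

/-! ### Weights -/

/-- The number of qubits in the state `|1⟩`. -/
def ones {N : ℕ} (x : Fin N → Fin 2) : ℕ := (Finset.univ.filter fun n => x n = 1).card

theorem ones_comp_perm {N : ℕ} (x : Fin N → Fin 2) (p : Equiv.Perm (Fin N)) :
    ones (x ∘ p) = ones x := by
  refine Finset.card_equiv p fun n => ?_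
  simp

theorem ones_eq_sum {N : ℕ} (x : Fin N → Fin 2) : ones x = ∑ n, (x n : ℕ) := by
  rw [ones, Finset.card_filter]
  refine Finset.sum_congr rfl fun n _ => ?_
  rcases (by omega : x n = 0 ∨ x n = 1) with h | h <;> simp [h]

/-- The fibres of x and y over 0 and over 1 have equal sizes; bijections between them glue to a
permutation. -/
theorem exists_perm_of_ones_eq {N : ℕ} {x y : Fin N → Fin 2} (h : ones x = ones y) :
    ∃ p : Equiv.Perm (Fin N), x = y ∘ p := by
  have h1 : Fintype.card {n // x n = 1} = Fintype.card {n // y n = 1} := by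
    simpa [Fintype.card_subtype, ones] using h
  have h0 : Fintype.card {n // x n = 0} = Fintype.card {n // y n = 0} := by
    have key : ∀ z : Fin N → Fin 2,
        Fintype.card {n // z n = 0} + Fintype.card {n // z n = 1} = N := by
      intro z
      simp only [Fintype.card_subtype]
      have hz : (Finset.univ.filter fun n => z n = 1) =
          Finset.univ.filter fun n => ¬ z n = 0 := by
        refine Finset.filter_congr fun n _ => ?_
        omega
      rw [hz, Finset.card_filter_add_card_filter_not]
      simp
    have := key x
    have := key y
    omega
  have hc : ∀ c : Fin 2, Nonempty ({n // x n = c} ≃ {n // y n = c}) := by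
    intro c
    rw [← Fintype.card_eq]
    rcases (by omega : c = 0 ∨ c = 1) with hc | hc
    · subst hc; exact h0
    · subst hc; exact h1
  refine ⟨Equiv.ofFiberEquiv fun c => (hc c).some, ?_⟩
  funext n
  exact (Equiv.ofFiberEquiv_map _ n).symm

theorem sigmaMinus_eq : sigmaMinus = !![0, 0; 1, 0] := by
  ext i j
  fin_cases i <;> fin_cases j <;> simp [sigmaMinus, pauli] <;> norm_num

theorem sigmaMinus_conjTranspose : sigmaMinusᴴ = !![0, 1; 0, 0] := by
  rw [sigmaMinus_eq]
  ext i j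
  fin_cases i <;> fin_cases j <;> simp

theorem raising_mulVec {N : ℕ} (u : (Fin N → Fin 2) → ℂ) (x : Fin N → Fin 2) :
    (collective N sigmaMinusᴴ *ᵥ u) x =
      ∑ n, if x n = 0 then u (Function.update x n 1) else 0 := by
  rw [collective_mulVec, sigmaMinus_conjTranspose]
  refine Finset.sum_congr rfl fun n _ => ?_
  rcases (by omega : x n = 0 ∨ x n = 1) with h | h <;> simp [h, Fin.sum_univ_two]

theorem collective_pauli_two_mulVec {N : ℕ} (u : (Fin N → Fin 2) → ℂ) (x : Fin N → Fin 2) :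
    (collective N (pauli 2) *ᵥ u) x = ((N : ℂ) - 2 * ones x) * u x := by
  have h : ∀ n, ∑ b, pauli 2 (x n) b * u (Function.update x n b) =
      (1 - 2 * ((x n : ℕ) : ℂ)) * u x := by
    intro n
    have hu := Function.update_eq_self n x
    rcases (by omega : x n = 0 ∨ x n = 1) with h | h <;> rw [h] at hu ⊢ <;>
      simp [Fin.sum_univ_two, pauli, hu] <;> ring
  rw [collective_mulVec, Finset.sum_congr rfl fun n _ => h n, ← Finset.sum_mul, ones_eq_sum]
  congr 1
  push_cast
  rw [Finset.sum_sub_distrib, Finset.mul_sum]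
  simp

/-! ### The reference state -/

/-- The positions of the qubits: `2 j` single ones, followed by `s` pairs. -/
def slot (N : ℕ) (s : Fin (N / 2 + 1)) : Fin (twoJ N s) ⊕ Fin (s : ℕ) × Fin 2 ≃ Fin N :=
  ((Equiv.sumCongr (Equiv.refl _) finProdFinEquiv).trans finSumFinEquiv).trans
    (finCongr (by have := s.2; simp only [twoJ]; omega))

theorem referenceState_apply {N : ℕ} (s : Fin (N / 2 + 1)) (x : Fin N → Fin 2) :
    referenceState N s x = (∏ n, if x (slot N s (.inl n)) = 0 then (1 : ℂ) else 0) *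
      ∏ i, singlet (x (slot N s (.inr (i, 0)))) (x (slot N s (.inr (i, 1)))) := by
  simp only [referenceState]
  congr 1
  refine Finset.prod_congr rfl fun i _ => ?_
  congr 2 <;>
  · apply Fin.ext
    simp [slot]
    try omega

/-- A nonzero amplitude needs 0 at every unpaired site and exactly one 1 in every pair. -/
theorem ones_of_referenceState_ne_zero {N : ℕ} {s : Fin (N / 2 + 1)} {x : Fin N → Fin 2}
    (h : referenceState N s x ≠ 0) : ones x = s := by
  rw [referenceState_apply] at h
  have h1 := Finset.prod_ne_zero_iff.mp (left_ne_zero_of_mul h)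
  have h2 := Finset.prod_ne_zero_iff.mp (right_ne_zero_of_mul h)
  rw [ones_eq_sum, ← Equiv.sum_comp (slot N s), Fintype.sum_sum_type, Finset.sum_eq_zero, zero_add,
    Fintype.sum_prod_type]
  · rw [Finset.sum_congr rfl (g := fun _ => 1), Finset.sum_const, Finset.card_univ,
      Fintype.card_fin, smul_eq_mul, mul_one]
    intro i _
    have := h2 i (Finset.mem_univ _)
    rw [Fin.sum_univ_two]
    revert this
    generalize x (slot N s (.inr (i, 0))) = a
    generalize x (slot N s (.inr (i, 1))) = b
    fin_cases a <;> fin_cases b <;> simp [singlet]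
  · intro n _
    have := h1 n (Finset.mem_univ _)
    simp only [ne_eq, ite_eq_right_iff, one_ne_zero, imp_false, not_not] at this
    simp [this]

theorem singlet_raise (a b : Fin 2) :
    (if a = 0 then singlet 1 b else 0) + (if b = 0 then singlet a 1 else 0) = 0 := by
  fin_cases a <;> fin_cases b <;> simp [singlet]

theorem raising_referenceState {N : ℕ} (s : Fin (N / 2 + 1)) :
    collective N sigmaMinusᴴ *ᵥ (referenceState N s).ofLp = 0 := by
  funext x
  rw [raising_mulVec, ← Equiv.sum_comp (slot N s), Fintype.sum_sum_type, Finset.sum_eq_zero,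
    zero_add, Fintype.sum_prod_type, Finset.sum_eq_zero, Pi.zero_apply]
  · intro i _
    -- The two flips inside pair i share all factors outside that pair, so their sum contains the
    -- raised singlet as a factor.
    have key : ∀ b, referenceState N s (Function.update x (slot N s (.inr (i, b))) 1) =
        ((∏ n, if x (slot N s (.inl n)) = 0 then (1 : ℂ) else 0) *
          ∏ i' ∈ Finset.univ.erase i,
            singlet (x (slot N s (.inr (i', 0)))) (x (slot N s (.inr (i', 1))))) *
          singlet (if b = 0 then 1 else x (slot N s (.inr (i, 0))))
            (if b = 1 then 1 else x (slot N s (.inr (i, 1)))) := by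
      intro b
      rw [referenceState_apply, ← Finset.prod_erase_mul _ _ (Finset.mem_univ i), ← mul_assoc]
      congr 1
      · congr 1
        · refine Finset.prod_congr rfl fun n _ => ?_
          rw [Function.update_of_ne]
          simp
        · refine Finset.prod_congr rfl fun i' hi' => ?_
          have := Finset.ne_of_mem_erase hi'
          rw [Function.update_of_ne, Function.update_of_ne] <;> simp [this]
      · simp [Function.update_apply, eq_comm]
    rw [Fin.sum_univ_two, key, key]
    have := singlet_raise (x (slot N s (.inr (i, 0)))) (x (slot N s (.inr (i, 1))))
    simp only [if_true, zero_ne_one, one_ne_zero, if_false]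
    rw [← mul_ite_zero, ← mul_ite_zero, ← mul_add, this, mul_zero]
  · intro n _
    rw [ite_eq_right_iff]
    intro _
    rw [referenceState_apply, Finset.prod_eq_zero (Finset.mem_univ n), zero_mul]
    simp

/-- The product state with the second qubit of every pair in the state `|1⟩`. -/
def pairConfig (N : ℕ) (s : Fin (N / 2 + 1)) : Fin N → Fin 2 :=
  fun n => Sum.elim (fun _ => 0) Prod.snd ((slot N s).symm n)

theorem referenceState_pairConfig_ne_zero {N : ℕ} (s : Fin (N / 2 + 1)) :
    referenceState N s (pairConfig N s) ≠ 0 := by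
  rw [referenceState_apply]
  simp [pairConfig, singlet]

theorem ones_pairConfig {N : ℕ} (s : Fin (N / 2 + 1)) : ones (pairConfig N s) = s :=
  ones_of_referenceState_ne_zero (referenceState_pairConfig_ne_zero s)

/-- The number of qubits that are in the state `|1⟩` in `x` and in the state `|0⟩` in `x₀`. -/
def excess {N : ℕ} (x₀ x : Fin N → Fin 2) : ℕ :=
  (Finset.univ.filter fun n => x₀ n = 0 ∧ x n = 1).card

-- A singlet factor is negative only when the first qubit of its pair is 1. The sites where
-- `pairConfig` is 0 are these first qubits and the unpaired sites, and a 1 at an unpaired site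
-- makes the amplitude vanish. So the excess counts the signs.
open scoped ComplexOrder in
theorem referenceState_sign {N : ℕ} (s : Fin (N / 2 + 1)) (x : Fin N → Fin 2) :
    0 ≤ (-1) ^ excess (pairConfig N s) x * referenceState N s x := by
  have h : ((-1 : ℂ)) ^ excess (pairConfig N s) x =
      (∏ n, if x (slot N s (.inl n)) = 1 then (-1 : ℂ) else 1) *
        ∏ i, if x (slot N s (.inr (i, 0))) = 1 then (-1 : ℂ) else 1 := by
    rw [excess, ← Finset.prod_const, Finset.prod_filter,
      ← Equiv.prod_comp (slot N s), Fintype.prod_sum_type, Fintype.prod_prod_type]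
    simp [pairConfig, Fin.prod_univ_two]
  rw [h, referenceState_apply, mul_mul_mul_comm, ← Finset.prod_mul_distrib,
    ← Finset.prod_mul_distrib]
  refine mul_nonneg (Finset.prod_nonneg fun n _ => ?_) (Finset.prod_nonneg fun i _ => ?_)
  · generalize x (slot N s (.inl n)) = a
    fin_cases a <;> simp
  · generalize x (slot N s (.inr (i, 0))) = a
    generalize x (slot N s (.inr (i, 1))) = b
    fin_cases a <;> fin_cases b <;> simp [singlet]

/-! ### Highest weight vectors are determined by their overlaps with the reference states -/

theorem update_update_eq_comp_swap {N : ℕ} {x : Fin N → Fin 2} {i n : Fin N} (hi : x i = 1)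
    (hn : Function.update x i 0 n = 0) :
    Function.update (Function.update x i 0) n 1 = x ∘ Equiv.swap i n := by
  funext k
  simp only [Function.update_apply, Function.comp_apply, Equiv.swap_apply_def] at hn ⊢
  split_ifs at hn ⊢ <;> simp_all

-- Reset to 0 an excess site i of x, obtaining y, and read J_+ g = 0 at y: the sum of g over all
-- ways of raising one 0 of y to 1 vanishes. Raising a site where x₀ is 0 gives a configuration
-- related to x by a swap fixing x₀, so it contributes g(x) again; raising a site where x₀ is 1
-- lowers the excess by one. Solving for g(x) flips the sign.
open scoped ComplexOrder in
theorem sign_of_raising_eq_zero {N : ℕ} {x₀ : Fin N → Fin 2} {g : (Fin N → Fin 2) → ℂ}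
    (hg : collective N sigmaMinusᴴ *ᵥ g = 0)
    (hsymm : ∀ (p : Equiv.Perm (Fin N)) x, x₀ ∘ p = x₀ → g (x ∘ p) = g x) (c : ℕ) :
    ∀ x, ones x = ones x₀ → excess x₀ x = c → ∃ ρ : ℂ, 0 ≤ ρ ∧ (-1) ^ c * g x = ρ * g x₀ := by
  induction c with
  | zero =>
    intro x hx hc
    refine ⟨1, zero_le_one, ?_⟩
    have hsub : (Finset.univ.filter fun n => x n = 1) ⊆
        Finset.univ.filter fun n => x₀ n = 1 := by
      intro n hn
      by_contra hn'
      have : n ∈ Finset.univ.filter fun n => x₀ n = 0 ∧ x n = 1 := by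
        simp only [Finset.mem_filter, Finset.mem_univ, true_and] at hn hn' ⊢
        exact ⟨by omega, hn⟩
      rw [Finset.card_eq_zero.mp hc] at this
      simp at this
    have heq := Finset.eq_of_subset_of_card_le hsub hx.ge
    have : x = x₀ := by
      funext n
      have := Finset.ext_iff.mp heq n
      simp only [Finset.mem_filter, Finset.mem_univ, true_and] at this
      omega
    simp [this]
  | succ c ih =>
    intro x hx hc
    obtain ⟨i, hi⟩ : (Finset.univ.filter fun n => x₀ n = 0 ∧ x n = 1).Nonempty := by
      rw [← Finset.card_pos]
      change 0 < excess x₀ x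
      omega
    simp only [Finset.mem_filter, Finset.mem_univ, true_and] at hi
    obtain ⟨hi0, hi1⟩ := hi
    set y := Function.update x i 0 with hy
    have hzero := congrFun hg y
    rw [raising_mulVec, Pi.zero_apply] at hzero
    have hterm : ∀ n, ∃ ρ : ℂ, 0 ≤ ρ ∧ (-1) ^ c * (if y n = 0 then g (Function.update y n 1) else 0)
        = (if y n = 0 ∧ x₀ n = 0 then (-1) ^ c * g x else 0) + ρ * g x₀ := by
      intro n
      by_cases hn : y n = 0
      · rw [if_pos hn, update_update_eq_comp_swap hi1 hn]
        by_cases hn0 : x₀ n = 0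
        · refine ⟨0, le_rfl, ?_⟩
          rw [if_pos ⟨hn, hn0⟩, hsymm]
          · ring
          · funext k
            simp only [Function.comp_apply, Equiv.swap_apply_def]
            split_ifs <;> simp_all
        · have hni : n ≠ i := by rintro rfl; exact hn0 hi0
          have hxn : x n = 0 := by simpa [hy, hni] using hn
          obtain ⟨ρ, h1, h2⟩ := ih (x ∘ Equiv.swap i n) (by rw [ones_comp_perm, hx]) (by
            have : (Finset.univ.filter fun k => x₀ k = 0 ∧ (x ∘ Equiv.swap i n) k = 1) =
                (Finset.univ.filter fun k => x₀ k = 0 ∧ x k = 1).erase i := by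
              ext k
              rw [Finset.mem_erase, Finset.mem_filter, Finset.mem_filter]
              simp only [Finset.mem_univ, true_and, Function.comp_apply, Equiv.swap_apply_def]
              split_ifs <;> simp_all
            rw [excess, this, Finset.card_erase_of_mem (by simp [hi0, hi1])]
            change excess x₀ x - 1 = c
            omega)
          exact ⟨ρ, h1, by rw [h2, if_neg (by simp [hn0]), zero_add]⟩
      · exact ⟨0, le_rfl, by simp [hn]⟩
    choose ρ hρ0 hρ using hterm
    have hsum : ((Finset.univ.filter fun n => y n = 0 ∧ x₀ n = 0).card : ℂ) * ((-1) ^ c * g x) +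
        (∑ n, ρ n) * g x₀ = 0 := by
      rw [Finset.sum_mul, ← nsmul_eq_mul, ← Finset.sum_const, Finset.sum_filter,
        ← Finset.sum_add_distrib, ← Finset.sum_congr rfl fun n _ => hρ n, ← Finset.mul_sum, hzero,
        mul_zero]
    -- Site i itself is counted, so the multiplicity of g(x) can be divided out.
    have hK : 0 < (Finset.univ.filter fun n => y n = 0 ∧ x₀ n = 0).card :=
      Finset.card_pos.mpr ⟨i, by simp [hy, hi0]⟩
    set K := (Finset.univ.filter fun n => y n = 0 ∧ x₀ n = 0).card
    have hKne : (K : ℂ) ≠ 0 := by exact_mod_cast hK.ne'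
    refine ⟨(K : ℂ)⁻¹ * ∑ n, ρ n, mul_nonneg ?_ (Finset.sum_nonneg fun n _ => hρ0 n), ?_⟩
    · rw [inv_nonneg]
      exact Nat.cast_nonneg K
    · apply mul_left_cancel₀ hKne
      rw [mul_assoc, mul_inv_cancel_left₀ hKne, pow_succ]
      linear_combination -hsum

-- Averaging over the stabilizer of x₀ preserves both hypotheses and supplies the symmetry needed by
-- `sign_of_raising_eq_zero`. The terms of the overlap are then nonnegative multiples of g(x₀), with
-- a nonzero multiple at x₀ itself.
open scoped ComplexOrder in
theorem apply_pairConfig_eq_zero {N : ℕ} {s : Fin (N / 2 + 1)} {u : (Fin N → Fin 2) → ℂ}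
    (hu : collective N sigmaMinusᴴ *ᵥ u = 0)
    (horth : ∀ p : Equiv.Perm (Fin N), ∑ x, referenceState N s (x ∘ p) * u x = 0) :
    u (pairConfig N s) = 0 := by
  classical
  set x₀ := pairConfig N s with hx₀
  set G := Finset.univ.filter fun p : Equiv.Perm (Fin N) => x₀ ∘ p = x₀ with hG
  set g : (Fin N → Fin 2) → ℂ := ∑ p ∈ G, permOp p *ᵥ u with hg
  have hg_apply : ∀ x, g x = ∑ p ∈ G, u (x ∘ p) := by
    intro x
    simp [hg, permOp_mulVec]
  have hg_raise : collective N sigmaMinusᴴ *ᵥ g = 0 := by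
    rw [hg, Matrix.mulVec_sum]
    refine Finset.sum_eq_zero fun p _ => ?_
    rw [collective_mulVec_permOp, hu, Matrix.mulVec_zero]
  have hg_symm : ∀ (p : Equiv.Perm (Fin N)) x, x₀ ∘ p = x₀ → g (x ∘ p) = g x := by
    intro p x hp
    rw [hg_apply, hg_apply, hG, Finset.sum_filter, Finset.sum_filter]
    rw [← Equiv.sum_comp (Equiv.mulLeft p) fun q : Equiv.Perm (Fin N) =>
      if x₀ ∘ q = x₀ then u (x ∘ q) else 0]
    refine Finset.sum_congr rfl fun q _ => ?_
    simp only [Equiv.coe_mulLeft, Equiv.Perm.coe_mul, ← Function.comp_assoc, hp]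
  have hg_orth : ∑ x, referenceState N s x * g x = 0 := by
    simp only [hg_apply, Finset.mul_sum]
    rw [Finset.sum_comm]
    refine Finset.sum_eq_zero fun p _ => ?_
    rw [← horth p.symm, ← Equiv.sum_comp (Equiv.arrowCongr p (Equiv.refl (Fin 2)))]
    refine Finset.sum_congr rfl fun x _ => ?_
    refine congrArg₂ (· * ·) rfl (congrArg u ?_)
    funext n
    simp [Equiv.arrowCongr]
  have hρ : ∀ x, ∃ ρ : ℂ, 0 ≤ ρ ∧ (x = x₀ → ρ ≠ 0) ∧
      referenceState N s x * g x = ρ * g x₀ := by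
    intro x
    by_cases hx : x = x₀
    · subst hx
      have := referenceState_sign s x₀
      have he : excess (pairConfig N s) x₀ = 0 := by
        rw [← hx₀, excess, Finset.card_eq_zero, Finset.filter_eq_empty_iff]
        intro n _
        omega
      rw [he, pow_zero, one_mul] at this
      exact ⟨_, this, fun _ => referenceState_pairConfig_ne_zero s, rfl⟩
    · by_cases h0 : referenceState N s x = 0
      · exact ⟨0, le_rfl, fun h => absurd h hx, by simp [h0]⟩
      · obtain ⟨ρ, h1, h2⟩ := sign_of_raising_eq_zero hg_raise hg_symm _ x
          ((ones_of_referenceState_ne_zero h0).trans (ones_pairConfig s).symm) rfl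
        refine ⟨_, mul_nonneg (referenceState_sign s x) h1, fun h => absurd h hx, ?_⟩
        rw [mul_assoc, ← h2, mul_mul_mul_comm, ← mul_pow]
        simp
  choose ρ hρ0 hρ1 hρ using hρ
  rw [Finset.sum_congr rfl fun x _ => hρ x, ← Finset.sum_mul, mul_eq_zero] at hg_orth
  rcases hg_orth with h | h
  · rw [Finset.sum_eq_zero_iff_of_nonneg fun x _ => hρ0 x] at h
    exact absurd (h x₀ (Finset.mem_univ _)) (hρ1 x₀ rfl)
  -- At x₀ every term of the stabilizer sum equals u(x₀), so g(x₀) = |G| u(x₀), and G contains the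
  -- identity.
  · rw [hg_apply, Finset.sum_congr rfl fun p hp => by
      rw [(Finset.mem_filter.mp hp).2], Finset.sum_const, smul_eq_zero] at h
    rcases h with h | h
    · rw [Finset.card_eq_zero] at h
      have : (1 : Equiv.Perm (Fin N)) ∈ G := by simp [hG]
      rw [h] at this
      simp at this
    · exact h

/-- Permutations act transitively on the configurations with s ones, and the hypotheses are
invariant under them, so vanishing at one configuration suffices. -/
theorem eq_zero_of_raising_eq_zero {N : ℕ} {s : Fin (N / 2 + 1)} {u : (Fin N → Fin 2) → ℂ}
    (hlevel : ∀ x, ones x ≠ s → u x = 0) (hu : collective N sigmaMinusᴴ *ᵥ u = 0)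
    (horth : ∀ p : Equiv.Perm (Fin N), ∑ x, referenceState N s (x ∘ p) * u x = 0) :
    u = 0 := by
  funext x
  by_cases hx : ones x = s
  · obtain ⟨p, rfl⟩ := exists_perm_of_ones_eq (hx.trans (ones_pairConfig s).symm)
    have := apply_pairConfig_eq_zero (s := s) (u := permOp p *ᵥ u)
      (by rw [collective_mulVec_permOp, hu, Matrix.mulVec_zero]) (by
        intro q
        rw [← horth (q.trans p.symm),
          ← Equiv.sum_comp (Equiv.arrowCongr p (Equiv.refl (Fin 2)))]
        refine Finset.sum_congr rfl fun x _ => ?_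
        rw [permOp_mulVec]
        refine congrArg₂ (· * ·) rfl (congrArg u ?_)
        funext n
        simp [Equiv.arrowCongr])
    rwa [permOp_mulVec] at this
  · exact hlevel x hx

/-! ### Collective spin operators on the Hilbert space -/

/-- The operator with the matrix `T`. -/
def opLin {N : ℕ} : QubitOp N →ₐ[ℂ] Module.End ℂ (Qubits N) :=
  AlgHom.ofLinearMap Matrix.toEuclideanLin.toLinearMap
    (by ext; simp)
    (fun A B => by ext; simp [Matrix.toLpLin_apply])

theorem toEuclideanLin_eq_opLin {N : ℕ} (T : QubitOp N) : Matrix.toEuclideanLin T = opLin T := rfl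

theorem opLin_apply {N : ℕ} (T : QubitOp N) (v : Qubits N) (x : Fin N → Fin 2) :
    opLin T v x = (T *ᵥ v.ofLp) x := rfl

theorem inner_opLin_left {N : ℕ} (T : QubitOp N) (v w : Qubits N) :
    inner ℂ (opLin T v) w = inner ℂ v (opLin Tᴴ w) := by
  rw [← toEuclideanLin_eq_opLin, ← toEuclideanLin_eq_opLin,
    Matrix.toEuclideanLin_conjTranspose_eq_adjoint, LinearMap.adjoint_inner_right]

/-- `J_-` -/
abbrev lowerEnd (N : ℕ) : Module.End ℂ (Qubits N) := opLin (collective N sigmaMinus)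

/-- `J_+` -/
abbrev raiseEnd (N : ℕ) : Module.End ℂ (Qubits N) := opLin (collective N sigmaMinusᴴ)

/-- `2 J_3` -/
abbrev weightEnd (N : ℕ) : Module.End ℂ (Qubits N) := opLin (collective N (pauli 2))

theorem raise_lower {N : ℕ} (u : Qubits N) :
    raiseEnd N (lowerEnd N u) = lowerEnd N (raiseEnd N u) + weightEnd N u := by
  have h : sigmaMinusᴴ * sigmaMinus - sigmaMinus * sigmaMinusᴴ = pauli 2 := by
    rw [sigmaMinus_conjTranspose, sigmaMinus_eq]
    ext i j
    fin_cases i <;> fin_cases j <;> simp [pauli]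
  rw [← Module.End.mul_apply, ← map_mul, collective_commutator, h, map_add, map_mul]
  rfl

theorem weight_lower {N : ℕ} (u : Qubits N) :
    weightEnd N (lowerEnd N u) = lowerEnd N (weightEnd N u) - (2 : ℂ) • lowerEnd N u := by
  have h : pauli 2 * sigmaMinus - sigmaMinus * pauli 2 = (-2 : ℂ) • sigmaMinus := by
    rw [sigmaMinus_eq]
    ext i j
    fin_cases i <;> fin_cases j <;> simp [pauli] <;> norm_num
  rw [← Module.End.mul_apply, ← map_mul, collective_commutator, h, map_add, map_mul, map_smul,
    map_smul, LinearMap.add_apply, neg_smul, LinearMap.neg_apply, ← sub_eq_add_neg]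
  rfl

theorem inner_lower_left {N : ℕ} (v w : Qubits N) :
    inner ℂ (lowerEnd N v) w = inner ℂ v (raiseEnd N w) := by
  rw [inner_opLin_left, collective_conjTranspose]

theorem inner_lower_pow_left {N : ℕ} (r : ℕ) (v w : Qubits N) :
    inner ℂ ((lowerEnd N ^ r) v) w = inner ℂ v ((raiseEnd N ^ r) w) := by
  induction r generalizing w with
  | zero => rfl
  | succ r ih => rw [pow_succ', Module.End.mul_apply, inner_lower_left, ih, pow_succ,
      Module.End.mul_apply]

/-- The vectors that are combinations of product states with `k` qubits in the state `|1⟩`. -/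
def levelSpace (N k : ℕ) : Submodule ℂ (Qubits N) where
  carrier := {v | ∀ x, ones x ≠ k → v x = 0}
  add_mem' hv hw x hx := by simp [hv x hx, hw x hx]
  zero_mem' x _ := rfl
  smul_mem' c v hv x hx := by simp [hv x hx]

theorem mem_levelSpace {N k : ℕ} {v : Qubits N} :
    v ∈ levelSpace N k ↔ ∀ x, ones x ≠ k → v x = 0 := Iff.rfl

theorem mem_levelSpace_iff_weight {N k : ℕ} {v : Qubits N} :
    v ∈ levelSpace N k ↔ weightEnd N v = ((N : ℂ) - 2 * k) • v := by
  rw [mem_levelSpace]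
  constructor
  · intro h
    ext x
    rw [opLin_apply, collective_pauli_two_mulVec, PiLp.smul_apply, smul_eq_mul]
    by_cases hx : ones x = k
    · rw [hx]
    · rw [h x hx]; simp
  · intro h x hx
    have := congrArg (fun w : Qubits N => w x) h
    simp only [opLin_apply, collective_pauli_two_mulVec, PiLp.smul_apply, smul_eq_mul] at this
    have hx' : (ones x : ℂ) - k ≠ 0 := sub_ne_zero.mpr (by exact_mod_cast hx)
    refine (mul_eq_zero.mp ?_).resolve_left hx'
    linear_combination -this / 2

theorem lower_pow_mem_levelSpace {N k : ℕ} {v : Qubits N} (hv : v ∈ levelSpace N k) (r : ℕ) :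
    (lowerEnd N ^ r) v ∈ levelSpace N (k + r) := by
  rw [mem_levelSpace_iff_weight] at hv ⊢
  rw [weight_pow_lowering weight_lower hv]
  congr 1
  push_cast
  ring

theorem raise_mem_levelSpace {N k : ℕ} {v : Qubits N} (hv : v ∈ levelSpace N (k + 1)) :
    raiseEnd N v ∈ levelSpace N k := by
  intro x hx
  rw [opLin_apply, raising_mulVec]
  refine Finset.sum_eq_zero fun n _ => ?_
  rw [ite_eq_right_iff]
  intro hn
  apply hv
  have : (Finset.univ.filter fun i => Function.update x n 1 i = 1) =
      insert n (Finset.univ.filter fun i => x i = 1) := by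
    ext i
    by_cases hi : i = n <;> simp [hi]
  rw [ones, this, Finset.card_insert_of_notMem (by simp [hn])]
  exact fun h => hx (Nat.succ_injective h)

theorem raise_eq_zero_of_mem_levelSpace_zero {N : ℕ} {v : Qubits N} (hv : v ∈ levelSpace N 0) :
    raiseEnd N v = 0 := by
  ext x
  rw [opLin_apply, raising_mulVec]
  refine Finset.sum_eq_zero fun n _ => ?_
  rw [ite_eq_right_iff]
  intro hn
  apply hv
  exact Finset.card_ne_zero_of_mem (a := n) (by simp)

theorem inner_eq_zero_of_mem_levelSpace {N k l : ℕ} {v w : Qubits N} (hv : v ∈ levelSpace N k)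
    (hw : w ∈ levelSpace N l) (hkl : k ≠ l) : inner ℂ v w = 0 := by
  rw [PiLp.inner_apply]
  refine Finset.sum_eq_zero fun x _ => ?_
  by_cases hx : ones x = k
  · rw [hw x (hx ▸ hkl), inner_zero_right]
  · rw [hv x hx, inner_zero_left]

/-! ### The multiplicity spaces -/

theorem multSpace_le_levelSpace (N : ℕ) (s : Fin (N / 2 + 1)) :
    multSpace N s ≤ levelSpace N s := by
  rw [multSpace, Submodule.span_le]
  rintro _ ⟨p, rfl⟩ x hx
  change opLin (permOp p) (referenceState N s) x = 0
  rw [opLin_apply, permOp_mulVec]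
  by_contra h
  exact hx (by rw [← ones_of_referenceState_ne_zero h, ones_comp_perm])

theorem raise_eq_zero_of_mem_multSpace {N : ℕ} {s : Fin (N / 2 + 1)} {v : Qubits N}
    (hv : v ∈ multSpace N s) : raiseEnd N v = 0 := by
  have : multSpace N s ≤ LinearMap.ker (raiseEnd N) := by
    rw [multSpace, Submodule.span_le]
    rintro _ ⟨p, rfl⟩
    change opLin _ (opLin (permOp p) (referenceState N s)) = 0
    ext x
    rw [opLin_apply]
    change (_ *ᵥ (permOp p *ᵥ (referenceState N s).ofLp)) x = 0
    rw [collective_mulVec_permOp, raising_referenceState, Matrix.mulVec_zero, Pi.zero_apply]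
  exact this hv

theorem twoJ_cast {N : ℕ} {K : Type*} [Ring K] (s : Fin (N / 2 + 1)) :
    (twoJ N s : K) = N - 2 * (s : ℕ) := by
  rw [twoJ, Nat.cast_sub]
  · push_cast
    rfl
  · have := s.2
    omega

theorem weight_of_mem_multSpace {N : ℕ} {s : Fin (N / 2 + 1)} {v : Qubits N}
    (hv : v ∈ multSpace N s) : weightEnd N v = (twoJ N s : ℂ) • v := by
  rw [mem_levelSpace_iff_weight.mp (multSpace_le_levelSpace N s hv), twoJ_cast]

theorem referenceState_mem_multSpace (N : ℕ) (s : Fin (N / 2 + 1)) :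
    referenceState N s ∈ multSpace N s := by
  refine Submodule.subset_span ⟨1, ?_⟩
  change opLin (permOp 1) (referenceState N s) = _
  ext x
  rw [opLin_apply, permOp_mulVec]
  rfl

theorem nonempty_of_basis_multSpace {N : ℕ} {s : Fin (N / 2 + 1)} {κ : Type*} [Fintype κ]
    (b : OrthonormalBasis κ ℂ (multSpace N s)) : Nonempty κ := by
  by_contra h
  rw [not_nonempty_iff] at h
  have h0 : (⟨_, referenceState_mem_multSpace N s⟩ : multSpace N s) = 0 := by
    rw [← b.sum_repr ⟨_, referenceState_mem_multSpace N s⟩]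
    exact Finset.sum_of_isEmpty _
  have h1 := congrArg Subtype.val h0
  apply referenceState_pairConfig_ne_zero s
  change referenceState N s = 0 at h1
  rw [h1]
  rfl

theorem eq_zero_of_raise_eq_zero_of_orthogonal {N : ℕ} {s : Fin (N / 2 + 1)} {w : Qubits N}
    (hw : w ∈ levelSpace N s) (he : raiseEnd N w = 0)
    (horth : ∀ v ∈ multSpace N s, inner ℂ v w = 0) : w = 0 := by
  have : w.ofLp = 0 := by
    refine eq_zero_of_raising_eq_zero hw (congrArg WithLp.ofLp he) fun p => ?_
    have h := horth _ (Submodule.subset_span ⟨p, rfl⟩)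
    change inner ℂ (opLin (permOp p) (referenceState N s)) w = 0 at h
    rw [PiLp.inner_apply] at h
    rw [← h]
    refine Finset.sum_congr rfl fun x _ => ?_
    rw [RCLike.inner_apply, opLin_apply, permOp_mulVec, mul_comm]
    congr 1
    -- The reference amplitudes are real, so the conjugation in the inner product disappears.
    rw [referenceState_apply, map_mul, map_prod, map_prod]
    congr 1
    · refine Finset.prod_congr rfl fun n _ => ?_
      split_ifs <;> simp
    · refine Finset.prod_congr rfl fun n _ => ?_
      simp only [singlet]
      split_ifs <;> simp
  ext x
  exact congrFun this x

/-- A highest weight cannot be negative: ‖J_- w‖² = ⟨w, J_+ J_- w⟩ = (N - 2k) ‖w‖². -/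
theorem eq_zero_of_raise_eq_zero_of_large {N k : ℕ} {w : Qubits N} (hk : N < 2 * k)
    (hw : w ∈ levelSpace N k) (he : raiseEnd N w = 0) : w = 0 := by
  rw [mem_levelSpace_iff_weight] at hw
  have h := inner_lower_left w (lowerEnd N w)
  rw [raise_lower, he, map_zero, zero_add, hw, inner_smul_right, inner_self_eq_norm_sq_to_K,
    inner_self_eq_norm_sq_to_K] at h
  have h' : ‖lowerEnd N w‖ ^ 2 = ((N : ℝ) - 2 * k) * ‖w‖ ^ 2 := by
    apply Complex.ofReal_injective
    push_cast
    exact h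
  have hk' : (N : ℝ) - 2 * k < 0 := by
    have : (N : ℝ) < 2 * k := by exact_mod_cast hk
    linarith
  by_contra hw0
  have := mul_neg_of_neg_of_pos hk' (pow_pos (norm_pos_iff.mpr hw0) 2)
  have := sq_nonneg ‖lowerEnd N w‖
  linarith

theorem eq_zero_of_orthogonal_of_mem_levelSpace {N : ℕ} (k : ℕ) : ∀ w ∈ levelSpace N k,
    (∀ (s : Fin (N / 2 + 1)) (r : ℕ), ∀ v ∈ multSpace N s,
      inner ℂ ((lowerEnd N ^ r) v) w = 0) → w = 0 := by
  have hw_of_raise : ∀ k, ∀ w ∈ levelSpace N k, (∀ (s : Fin (N / 2 + 1)) (r : ℕ),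
      ∀ v ∈ multSpace N s, inner ℂ ((lowerEnd N ^ r) v) w = 0) → raiseEnd N w = 0 → w = 0 := by
    intro k w hw horth he
    rcases lt_or_ge N (2 * k) with hk | hk
    · exact eq_zero_of_raise_eq_zero_of_large hk hw he
    · exact eq_zero_of_raise_eq_zero_of_orthogonal (s := ⟨k, by omega⟩) hw he
        fun v hv => horth _ 0 v hv
  induction k with
  | zero =>
    exact fun w hw horth => hw_of_raise 0 w hw horth (raise_eq_zero_of_mem_levelSpace_zero hw)
  | succ k ih =>
    refine fun w hw horth => hw_of_raise _ w hw horth (ih _ (raise_mem_levelSpace hw) ?_)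
    intro s r v hv
    -- By adjointness, J_+ w is tested against lowered vectors with one more J_-, which the
    -- hypothesis already covers.
    rw [← inner_lower_left, ← Module.End.mul_apply, ← pow_succ']
    exact horth s _ v hv

/-- Each lowered vector lies in a single level, so projecting w onto a level preserves the
orthogonality. -/
theorem eq_zero_of_orthogonal {N : ℕ} {w : Qubits N}
    (horth : ∀ (s : Fin (N / 2 + 1)) (r : ℕ), ∀ v ∈ multSpace N s,
      inner ℂ ((lowerEnd N ^ r) v) w = 0) : w = 0 := by
  have key : ∀ k, (WithLp.toLp 2 fun x => if ones x = k then w x else 0 : Qubits N) = 0 := by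
    intro k
    refine eq_zero_of_orthogonal_of_mem_levelSpace k _ (fun x hx => if_neg hx) fun s r v hv => ?_
    have hlevel := lower_pow_mem_levelSpace (multSpace_le_levelSpace N s hv) r
    by_cases hk : (s : ℕ) + r = k
    · rw [← horth s r v hv, PiLp.inner_apply, PiLp.inner_apply]
      refine Finset.sum_congr rfl fun x _ => ?_
      by_cases hx : ones x = k
      · simp [hx]
      · rw [hlevel x (hk ▸ hx), inner_zero_left, inner_zero_left]
    · exact inner_eq_zero_of_mem_levelSpace hlevel (fun x hx => if_neg hx) hk
  ext x
  have := congrArg (fun v : Qubits N => v x) (key (ones x))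
  simpa using this

/-! ### The spin basis -/

/-- The squared norm of `J_-^r v` for a highest weight unit vector `v` of weight `d`. -/
def ladderSq (d r : ℕ) : ℝ := ∏ i ∈ Finset.range r, (((i : ℝ) + 1) * (d - i))

theorem ladderSq_succ (d r : ℕ) : ladderSq d (r + 1) = ladderSq d r * ((r + 1) * (d - r)) :=
  Finset.prod_range_succ _ _

theorem ladderSq_pos {d r : ℕ} (h : r ≤ d) : 0 < ladderSq d r := by
  refine Finset.prod_pos fun i hi => mul_pos (by positivity) (sub_pos.mpr ?_)
  exact_mod_cast (Finset.mem_range.mp hi).trans_le h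

/-- Lowerings on one side become raisings on the other: equally many return a multiple of the
highest weight vector, and one more annihilates it. -/
theorem inner_lower_pow {N : ℕ} {s s' : Fin (N / 2 + 1)} {v w : Qubits N}
    (hv : v ∈ multSpace N s) (hw : w ∈ multSpace N s') (r q : ℕ) :
    inner ℂ ((lowerEnd N ^ r) v) ((lowerEnd N ^ q) w) =
      if r = q then (ladderSq (twoJ N s') r : ℂ) * inner ℂ v w else 0 := by
  have key : ∀ {s : Fin (N / 2 + 1)} {v w : Qubits N} {r q : ℕ}, w ∈ multSpace N s → q < r →
      inner ℂ ((lowerEnd N ^ r) v) ((lowerEnd N ^ q) w) = 0 := by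
    intro s v w r q hw hrq
    rw [inner_lower_pow_left, raising_pow_pow_lowering_eq_zero raise_lower weight_lower
      (weight_of_mem_multSpace hw) (raise_eq_zero_of_mem_multSpace hw) hrq, inner_zero_right]
  split_ifs with h
  · subst h
    rw [inner_lower_pow_left, raising_pow_pow_lowering raise_lower weight_lower
      (weight_of_mem_multSpace hw) (raise_eq_zero_of_mem_multSpace hw), inner_smul_right]
    simp [ladderSq]
  · rcases lt_or_gt_of_ne h with h | h
    · rw [← inner_conj_symm, key hv h, map_zero]
    · exact key hw h

theorem norm_lower_pow {N : ℕ} {s : Fin (N / 2 + 1)} {v : Qubits N}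
    (hv : v ∈ multSpace N s) (hv1 : ‖v‖ = 1) (r : ℕ) :
    ‖(lowerEnd N ^ r) v‖ = √(ladderSq (twoJ N s) r) := by
  have h := inner_lower_pow hv hv r r
  rw [if_pos rfl, inner_self_eq_norm_sq_to_K, inner_self_eq_norm_sq_to_K, hv1] at h
  rw [← Real.sqrt_sq (norm_nonneg _)]
  congr 1
  apply Complex.ofReal_injective
  push_cast
  simpa using h

theorem lowered_eq {N : ℕ} {s : Fin (N / 2 + 1)} {v : Qubits N}
    (hv : v ∈ multSpace N s) (hv1 : ‖v‖ = 1) (r : ℕ) :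
    lowered v r = (((√(ladderSq (twoJ N s) r))⁻¹ : ℝ) : ℂ) • (lowerEnd N ^ r) v := by
  rw [lowered, toEuclideanLin_eq_opLin, collectiveLowering_eq, map_pow, norm_lower_pow hv hv1]

section SpinBasis

variable {N : ℕ} {κ : Fin (N / 2 + 1) → Type*} [∀ s, Fintype (κ s)]

theorem orthonormal_lowered (b : ∀ s : Fin (N / 2 + 1), OrthonormalBasis (κ s) ℂ (multSpace N s)) :
    Orthonormal ℂ fun i : SpinIndex N κ => lowered (b i.1 i.2.2 : Qubits N) i.2.1 := by
  classical
  rw [orthonormal_iff_ite]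
  rintro ⟨s, r, α⟩ ⟨s', r', α'⟩
  have h1 : ∀ s α, ‖(b s α : Qubits N)‖ = 1 := fun s α => (b s).orthonormal.1 α
  dsimp only
  rw [lowered_eq (b s α).2 (h1 s α), lowered_eq (b s' α').2 (h1 s' α'), inner_smul_left,
    inner_smul_right, inner_lower_pow (b s α).2 (b s' α').2]
  by_cases hs : s = s'
  · subst hs
    have h2 : inner ℂ (b s α : Qubits N) (b s α') = if α = α' then 1 else 0 :=
      orthonormal_iff_ite.mp (b s).orthonormal α α'
    rw [h2]
    by_cases hr : r = r'
    · subst hr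
      by_cases hα : α = α'
      · subst hα
        have hpos := ladderSq_pos (Nat.lt_succ_iff.mp r.2)
        simp only [if_true, mul_one, Complex.conj_ofReal]
        norm_cast
        rw [← mul_assoc, ← mul_inv, Real.mul_self_sqrt hpos.le, inv_mul_cancel₀ hpos.ne']
      · simp [hα]
    · have : (r : ℕ) ≠ r' := fun h => hr (Fin.ext h)
      simp [hr, this]
  -- For different spins the highest weight vectors themselves lie in different levels.
  · rw [inner_eq_zero_of_mem_levelSpace (multSpace_le_levelSpace N s (b s α).2)
      (multSpace_le_levelSpace N s' (b s' α').2) (fun h => hs (Fin.ext h))]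
    simp [hs]

theorem lower_pow_eq_zero {s : Fin (N / 2 + 1)} {v : Qubits N} (hv : v ∈ multSpace N s) {r : ℕ}
    (hr : twoJ N s < r) : (lowerEnd N ^ r) v = 0 := by
  rw [← inner_self_eq_zero (𝕜 := ℂ), inner_lower_pow hv hv, if_pos rfl]
  have : ladderSq (twoJ N s) r = 0 :=
    Finset.prod_eq_zero (Finset.mem_range.mpr hr) (by simp)
  simp [this]

theorem span_lowered_orthogonal
    (b : ∀ s : Fin (N / 2 + 1), OrthonormalBasis (κ s) ℂ (multSpace N s)) :
    (Submodule.span ℂ (Set.range fun i : SpinIndex N κ =>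
      lowered (b i.1 i.2.2 : Qubits N) i.2.1))ᗮ = ⊥ := by
  rw [Submodule.eq_bot_iff]
  intro w hw
  refine eq_zero_of_orthogonal fun s r v hv => ?_
  rcases lt_or_ge (twoJ N s) r with hr | hr
  -- Powers beyond 2j are not represented in the basis, but they annihilate v.
  · rw [lower_pow_eq_zero hv hr, inner_zero_left]
  · have hb : ∀ α, inner ℂ ((lowerEnd N ^ r) (b s α : Qubits N)) w = 0 := by
      intro α
      have h := (Submodule.mem_orthogonal _ _).mp hw _
        (Submodule.subset_span ⟨⟨s, ⟨r, Nat.lt_succ_of_le hr⟩, α⟩, rfl⟩)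
      dsimp only at h
      rw [lowered_eq (b s α).2 ((b s).orthonormal.1 α), inner_smul_left, mul_eq_zero] at h
      refine h.resolve_left ?_
      have := (Real.sqrt_pos.mpr (ladderSq_pos hr)).ne'
      simpa using this
    have hv' : v = ∑ α, (b s).repr ⟨v, hv⟩ α • (b s α : Qubits N) := by
      have := congrArg Subtype.val ((b s).sum_repr ⟨v, hv⟩)
      simpa using this.symm
    rw [hv', map_sum, sum_inner]
    refine Finset.sum_eq_zero fun α _ => ?_
    rw [map_smul, inner_smul_left, hb, mul_zero]

/-- The basis of the vectors `|j, m, α⟩`. -/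
def spinBasis (b : ∀ s : Fin (N / 2 + 1), OrthonormalBasis (κ s) ℂ (multSpace N s)) :
    OrthonormalBasis (SpinIndex N κ) ℂ (Qubits N) :=
  OrthonormalBasis.mkOfOrthogonalEqBot (orthonormal_lowered b) (span_lowered_orthogonal b)

theorem spinBasis_apply (b : ∀ s : Fin (N / 2 + 1), OrthonormalBasis (κ s) ℂ (multSpace N s))
    (i : SpinIndex N κ) : spinBasis b i = lowered (b i.1 i.2.2 : Qubits N) i.2.1 := by
  simp [spinBasis]

theorem spinBasis_eq
    (b : ∀ s : Fin (N / 2 + 1), OrthonormalBasis (κ s) ℂ (multSpace N s))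
    (s : Fin (N / 2 + 1)) (r : Fin (twoJ N s + 1)) (α : κ s) :
    spinBasis b ⟨s, (r, α)⟩ =
      (((√(ladderSq (twoJ N s) r))⁻¹ : ℝ) : ℂ) • (lowerEnd N ^ (r : ℕ)) (b s α : Qubits N) := by
  rw [spinBasis_apply]
  exact lowered_eq (b s α).2 ((b s).orthonormal.1 α) r

theorem spinBasis_mem_levelSpace
    (b : ∀ s : Fin (N / 2 + 1), OrthonormalBasis (κ s) ℂ (multSpace N s))
    (s : Fin (N / 2 + 1)) (r : Fin (twoJ N s + 1)) (α : κ s) :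
    spinBasis b ⟨s, (r, α)⟩ ∈ levelSpace N (s + r) := by
  rw [spinBasis_eq]
  exact Submodule.smul_mem _ _
    (lower_pow_mem_levelSpace (multSpace_le_levelSpace N s (b s α).2) r)

end SpinBasis

/-! ### Block decompositions -/

section Blocks

variable {N : ℕ} {κ : Fin (N / 2 + 1) → Type*} [∀ s, Fintype (κ s)] [∀ s, DecidableEq (κ s)]
  {B : OrthonormalBasis (SpinIndex N κ) ℂ (Qubits N)} {T T' : QubitOp N}
  {A A' : ∀ s : Fin (N / 2 + 1), Matrix (Fin (twoJ N s + 1)) (Fin (twoJ N s + 1)) ℂ}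

/-- The matrix of an operator in the basis `B`. -/
def basisMatrix (B : OrthonormalBasis (SpinIndex N κ) ℂ (Qubits N)) :
    QubitOp N →ₐ[ℂ] Matrix (SpinIndex N κ) (SpinIndex N κ) ℂ :=
  (LinearMap.toMatrixAlgEquiv B.toBasis).toAlgHom.comp opLin

theorem basisMatrix_apply (T : QubitOp N) (i i' : SpinIndex N κ) :
    basisMatrix B T i i' = inner ℂ (B i) (opLin T (B i')) := by
  change LinearMap.toMatrix B.toBasis B.toBasis (opLin T) i i' = _
  rw [LinearMap.toMatrix_apply, OrthonormalBasis.coe_toBasis,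
    OrthonormalBasis.coe_toBasis_repr_apply, OrthonormalBasis.repr_apply_apply]

theorem basisMatrix_conjTranspose (T : QubitOp N) :
    basisMatrix B Tᴴ = (basisMatrix B T)ᴴ := by
  ext i i'
  rw [Matrix.conjTranspose_apply, basisMatrix_apply, basisMatrix_apply, ← inner_opLin_left,
    ← inner_conj_symm]
  rfl

theorem hasBlocks_iff : HasBlocks B T A ↔ basisMatrix B T =
    Matrix.blockDiagonal' fun s => A s ⊗ₖ (1 : Matrix (κ s) (κ s) ℂ) := Iff.rfl

theorem HasBlocks.add (h : HasBlocks B T A) (h' : HasBlocks B T' A') :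
    HasBlocks B (T + T') fun s => A s + A' s := by
  rw [hasBlocks_iff] at *
  rw [map_add, h, h', ← Matrix.blockDiagonal'_add]
  congr 1
  funext s
  exact (Matrix.add_kronecker _ _ _).symm

theorem HasBlocks.smul (c : ℂ) (h : HasBlocks B T A) :
    HasBlocks B (c • T) fun s => c • A s := by
  rw [hasBlocks_iff] at *
  rw [map_smul, h, ← Matrix.blockDiagonal'_smul]
  congr 1
  funext s
  exact (Matrix.smul_kronecker c (A s) 1).symm

theorem HasBlocks.mul (h : HasBlocks B T A) (h' : HasBlocks B T' A') :
    HasBlocks B (T * T') fun s => A s * A' s := by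
  rw [hasBlocks_iff] at *
  rw [map_mul, h, h', ← Matrix.blockDiagonal'_mul]
  congr 1
  funext s
  rw [← Matrix.mul_kronecker_mul, one_mul]

theorem HasBlocks.conjTranspose (h : HasBlocks B T A) :
    HasBlocks B Tᴴ fun s => (A s)ᴴ := by
  rw [hasBlocks_iff] at *
  rw [basisMatrix_conjTranspose, h, Matrix.blockDiagonal'_conjTranspose]
  congr 1
  funext s
  rw [Matrix.conjTranspose_kronecker, Matrix.conjTranspose_one]

/-- `A ↦ A ⊗ 1` -/
def kroneckerOneHom (m n : Type*) [Fintype m] [DecidableEq m] [Fintype n] [DecidableEq n] :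
    Matrix m m ℂ →ₐ[ℂ] Matrix (m × n) (m × n) ℂ :=
  AlgHom.ofLinearMap
    { toFun := fun A => A ⊗ₖ (1 : Matrix n n ℂ)
      map_add' := fun _ _ => Matrix.add_kronecker _ _ _
      map_smul' := fun _ _ => Matrix.smul_kronecker _ _ _ }
    Matrix.one_kronecker_one
    (fun A A' => by simp [← Matrix.mul_kronecker_mul])

-- Passing to the basis, forming block diagonals and tensoring with 1 all commute with the
-- exponential.
open scoped Matrix.Norms.Operator in
theorem HasBlocks.exp (h : HasBlocks B T A) :
    HasBlocks B (NormedSpace.exp T) fun s => NormedSpace.exp (A s) := by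
  rw [hasBlocks_iff] at *
  rw [Matrix.map_exp_algHom, h, Matrix.exp_blockDiagonal']
  congr 1
  funext s
  refine Eq.trans (Pi.coe_exp _ s) ?_
  exact (Matrix.map_exp_algHom (kroneckerOneHom _ _) (A s)).symm

theorem hasBlocks_of_apply (h : ∀ s r α, opLin T (B ⟨s, (r, α)⟩) = ∑ q, A s q r • B ⟨s, (q, α)⟩) :
    HasBlocks B T A := by
  rw [hasBlocks_iff]
  ext ⟨s, q, β⟩ ⟨s', r, α⟩
  rw [basisMatrix_apply, h, inner_sum]
  simp only [inner_smul_right, orthonormal_iff_ite.mp B.orthonormal]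
  by_cases hs : s = s'
  · subst hs
    rw [Matrix.blockDiagonal'_apply_eq, Matrix.kronecker_apply, Finset.sum_eq_single q]
    · by_cases hα : β = α <;> simp [hα, Matrix.one_apply]
    · intro q' _ hq'
      rw [if_neg, mul_zero]
      intro h
      simp only [Sigma.mk.injEq, heq_eq_eq, Prod.mk.injEq, true_and] at h
      exact hq' h.1.symm
    · simp
  · rw [Matrix.blockDiagonal'_apply_ne _ _ _ hs]
    refine Finset.sum_eq_zero fun q' _ => ?_
    rw [if_neg, mul_zero]
    intro h
    exact hs (congrArg Sigma.fst h)

theorem hasBlocks_diagonal {c : ∀ s : Fin (N / 2 + 1), Fin (twoJ N s + 1) → ℂ}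
    (h : ∀ s r α, opLin T (B ⟨s, (r, α)⟩) = c s r • B ⟨s, (r, α)⟩) :
    HasBlocks B T fun s => Matrix.diagonal (c s) := by
  refine hasBlocks_of_apply fun s r α => ?_
  rw [h, Finset.sum_eq_single r]
  · simp
  · intro q _ hq
    rw [Matrix.diagonal_apply_ne _ hq, zero_smul]
  · simp

variable (b : ∀ s : Fin (N / 2 + 1), OrthonormalBasis (κ s) ℂ (multSpace N s))

theorem hasBlocks_lowering :
    HasBlocks (spinBasis b) (collective N sigmaMinus) fun s => spinLowering (twoJ N s) := by
  refine hasBlocks_of_apply fun s r α => ?_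
  have hl : opLin (collective N sigmaMinus) (spinBasis b ⟨s, (r, α)⟩) =
      (((√(ladderSq (twoJ N s) r))⁻¹ : ℝ) : ℂ) •
        (lowerEnd N ^ ((r : ℕ) + 1)) (b s α : Qubits N) := by
    rw [spinBasis_eq, map_smul, pow_succ', Module.End.mul_apply]
  rw [hl]
  by_cases hr : (r : ℕ) + 1 ≤ twoJ N s
  · have hr' : (r : ℕ) + 1 < twoJ N s + 1 := Nat.lt_succ_of_le hr
    rw [Finset.sum_eq_single ⟨(r : ℕ) + 1, hr'⟩, spinBasis_eq, smul_smul]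
    · congr 1
      simp only [spinLowering, Matrix.of_apply, if_true]
      -- With m = j - r, j(j + 1) - m(m - 1) = (r + 1)(2j - r), the ratio of consecutive squared
      -- norms on the ladder.
      have hsq : ((twoJ N s : ℝ) / 2 * ((twoJ N s : ℝ) / 2 + 1) -
          ((twoJ N s : ℝ) / 2 - (r : ℕ)) * ((twoJ N s : ℝ) / 2 - (r : ℕ) - 1)) =
          ((r : ℕ) + 1) * (twoJ N s - (r : ℕ)) := by ring
      rw [hsq, ladderSq_succ, Real.sqrt_mul (ladderSq_pos (by omega)).le]
      have hpos : (0 : ℝ) < ((r : ℕ) + 1) * (twoJ N s - (r : ℕ)) := by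
        refine mul_pos (by positivity) (sub_pos.mpr ?_)
        exact_mod_cast hr
      have hne := (Real.sqrt_pos.mpr hpos).ne'
      rw [← Complex.ofReal_mul, mul_inv_rev, mul_inv_cancel_left₀ hne]
    · intro q _ hq
      have : (q : ℕ) ≠ r + 1 := fun h => hq (Fin.ext h)
      simp [spinLowering, this]
    · simp
  · rw [lower_pow_eq_zero (b s α).2 (by omega), smul_zero, Finset.sum_eq_zero]
    intro q _
    have := q.2
    have : (q : ℕ) ≠ r + 1 := by omega
    simp [spinLowering, this]

theorem hasBlocks_weight : HasBlocks (spinBasis b) (collective N (pauli 2)) fun s =>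
    Matrix.diagonal fun r => (twoJ N s : ℂ) - 2 * (r : ℕ) := by
  refine hasBlocks_diagonal fun s r α => ?_
  rw [mem_levelSpace_iff_weight.mp (spinBasis_mem_levelSpace b s r α), twoJ_cast]
  congr 1
  push_cast
  ring

theorem pauli_zero_eq : pauli 0 = sigmaMinusᴴ + sigmaMinus := by
  rw [sigmaMinus_conjTranspose, sigmaMinus_eq]
  ext i j
  fin_cases i <;> fin_cases j <;> simp [pauli]

theorem pauli_one_eq : pauli 1 = (1 / Complex.I) • (sigmaMinusᴴ + (-1 : ℂ) • sigmaMinus) := by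
  rw [sigmaMinus_conjTranspose, sigmaMinus_eq]
  ext i j
  fin_cases i <;> fin_cases j <;> simp [pauli]

/-- The first two Pauli matrices are combinations of σ_- and its adjoint, the third is read off from
the weights. -/
theorem hasBlocks_spinOp (l : Fin 3) :
    HasBlocks (spinBasis b) (collective N ((1 / 2 : ℂ) • pauli l))
      fun s => spinOp (twoJ N s) l := by
  have hm := hasBlocks_lowering b
  have hp := hm.conjTranspose
  rw [collective_conjTranspose] at hp
  fin_cases l
  · have := (hp.add hm).smul (1 / 2)
    rw [← map_add, ← map_smul, ← pauli_zero_eq] at this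
    exact this
  · have := ((hp.add (hm.smul (-1))).smul (1 / Complex.I)).smul (1 / 2)
    rw [← map_smul, ← map_add, ← map_smul, ← map_smul, ← pauli_one_eq] at this
    convert! this using 2 with s
    change (1 / (2 * Complex.I)) • ((spinLowering _)ᴴ - spinLowering _) = _
    rw [smul_smul, neg_smul, one_smul, ← sub_eq_add_neg]
    congr 1
    ring
  · have := (hasBlocks_weight b).smul (1 / 2)
    rw [← map_smul] at this
    convert! this using 2 with s
    simp only [spinOp, Matrix.smul_eq_diagonal_mul, Matrix.diagonal_mul_diagonal]
    change Matrix.diagonal _ = _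
    congr 1
    funext r
    ring

theorem hasBlocks_rotation (t : Fin 3 → ℝ) :
    HasBlocks (spinBasis b) (tensorOp fun _ => qubitRotation t)
      fun s => spinRotation (twoJ N s) t := by
  have h : (-Complex.I) • ∑ l, ((t l : ℂ) / 2) • pauli l = (-Complex.I) •
      ((t 0 : ℂ) • (1 / 2 : ℂ) • pauli 0 + (t 1 : ℂ) • (1 / 2 : ℂ) • pauli 1 +
        (t 2 : ℂ) • (1 / 2 : ℂ) • pauli 2) := by
    simp only [Fin.sum_univ_three, smul_smul]
    congr 3 <;> ring_nf
  simp only [qubitRotation]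
  rw [← exp_collective, h, map_smul, map_add, map_add, map_smul, map_smul (collective N) (t 1 : ℂ),
    map_smul (collective N) (t 2 : ℂ)]
  have := (((((hasBlocks_spinOp b 0).smul (t 0)).add ((hasBlocks_spinOp b 1).smul (t 1))).add
    ((hasBlocks_spinOp b 2).smul (t 2))).smul (-Complex.I)).exp
  convert! this using 2 with s
  simp only [spinRotation, Fin.sum_univ_three]

end Blocks

/-! ### Unitarity -/

theorem exp_neg_I_smul_mem_unitaryGroup {n : Type*} [Fintype n] [DecidableEq n]
    {A : Matrix n n ℂ} (hA : A.IsHermitian) :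
    NormedSpace.exp ((-Complex.I) • A) ∈ Matrix.unitaryGroup n ℂ := by
  rw [Matrix.mem_unitaryGroup_iff, Matrix.star_eq_conjTranspose, ← Matrix.exp_conjTranspose,
    Matrix.conjTranspose_smul, hA.eq, ← Matrix.exp_add_of_commute, ← add_smul]
  · simp
  · exact ((Commute.refl A).smul_left _).smul_right _

theorem isHermitian_sum_smul {n : Type*} {A : Fin 3 → Matrix n n ℂ} (hA : ∀ l, (A l).IsHermitian)
    (t : Fin 3 → ℝ) : (∑ l, (t l : ℂ) • A l).IsHermitian := by
  rw [Matrix.IsHermitian, Matrix.conjTranspose_sum]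
  refine Finset.sum_congr rfl fun l _ => ?_
  rw [Matrix.conjTranspose_smul, (hA l).eq]
  simp

theorem isHermitian_pauli (l : Fin 3) : (pauli l).IsHermitian := by
  ext i j
  fin_cases l <;> fin_cases i <;> fin_cases j <;> simp [pauli]

theorem isHermitian_spinOp (d : ℕ) (l : Fin 3) : (spinOp d l).IsHermitian := by
  fin_cases l
  · simp [spinOp, Matrix.IsHermitian, add_comm]
  · simp [spinOp, Matrix.IsHermitian]
    rw [← smul_neg, neg_sub]
  · ext i j
    by_cases h : i = j <;> simp [spinOp, h, eq_comm]

theorem spinRotation_mem_unitaryGroup (d : ℕ) (t : Fin 3 → ℝ) :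
    spinRotation d t ∈ Matrix.unitaryGroup (Fin (d + 1)) ℂ :=
  exp_neg_I_smul_mem_unitaryGroup (isHermitian_sum_smul (isHermitian_spinOp d) t)

theorem qubitRotation_mem_unitaryGroup (t : Fin 3 → ℝ) :
    qubitRotation t ∈ Matrix.unitaryGroup (Fin 2) ℂ := by
  have := exp_neg_I_smul_mem_unitaryGroup (isHermitian_sum_smul isHermitian_pauli fun l => t l / 2)
  simpa [qubitRotation] using this

/-! ### Measurement operators -/

theorem pauliDot_isHermitian (a : EuclideanSpace ℝ (Fin 3)) : (pauliDot a).IsHermitian := by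
  ext i j
  fin_cases i <;> fin_cases j <;> simp [pauliDot, pauli, Fin.sum_univ_three]

theorem pauli_two_eq_single :
    pauli 2 = Matrix.single 0 0 1 - Matrix.single 1 1 1 := by
  ext i j
  fin_cases i <;> fin_cases j <;> simp [pauli]

theorem one_eq_single :
    (1 : Matrix (Fin 2) (Fin 2) ℂ) = Matrix.single 0 0 1 + Matrix.single 1 1 1 := by
  ext i j
  fin_cases i <;> fin_cases j <;> simp

theorem single_zero_eq : Matrix.single 0 0 1 = (1 / 2 : ℂ) • (1 + pauli 2) := by
  rw [pauli_two_eq_single, one_eq_single]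
  module

theorem single_one_eq : Matrix.single 1 1 1 = (1 / 2 : ℂ) • (1 - pauli 2) := by
  rw [pauli_two_eq_single, one_eq_single]
  module

/-- The eigenvectors are fixed only up to phases; the projectors are not affected by them.
Eigenvectors of a Hermitian matrix for different eigenvalues are orthogonal, so the matrix K with
these columns is unitary and diagonalizes a · σ. -/
theorem vecMulVec_eq_of_isLocalBasis {a : EuclideanSpace ℝ (Fin 3)} {ket : Fin 2 → Fin 2 → ℂ}
    (h : IsLocalBasis a ket) :
    Matrix.vecMulVec (ket 0) (star (ket 0)) = (1 / 2 : ℂ) • (1 + pauliDot a) ∧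
      Matrix.vecMulVec (ket 1) (star (ket 1)) = (1 / 2 : ℂ) • (1 - pauliDot a) := by
  obtain ⟨h0, e0⟩ := h 0
  obtain ⟨h1, e1⟩ := h 1
  simp only [Fin.val_zero, pow_zero, one_smul, Fin.val_one, pow_one] at e0 e1
  have h01 : star (ket 0) ⬝ᵥ ket 1 = 0 := by
    have : star (ket 0) ⬝ᵥ (pauliDot a *ᵥ ket 1) = star (pauliDot a *ᵥ ket 0) ⬝ᵥ ket 1 := by
      rw [Matrix.star_mulVec, (pauliDot_isHermitian a).eq, Matrix.dotProduct_mulVec]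
    rw [e0, e1, dotProduct_smul, smul_eq_mul] at this
    linear_combination -this / 2
  have h10 : star (ket 1) ⬝ᵥ ket 0 = 0 := by
    rw [Matrix.star_dotProduct, h01, star_zero]
  set K : Matrix (Fin 2) (Fin 2) ℂ := Matrix.of fun x i => ket i x with hK
  have hKK : Kᴴ * K = 1 := by
    ext i j
    change star (ket i) ⬝ᵥ ket j = _
    fin_cases i <;> fin_cases j <;> simp [h0, h1, h01, h10]
  have hKK' : K * Kᴴ = 1 := mul_eq_one_comm.mp hKK
  have hP : ∀ i, Matrix.vecMulVec (ket i) (star (ket i)) = K * Matrix.single i i 1 * Kᴴ := by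
    intro i
    ext x y
    fin_cases i <;> simp [hK, Matrix.vecMulVec_apply, Matrix.mul_apply, Fin.sum_univ_two]
  have hA : pauliDot a = K * pauli 2 * Kᴴ := by
    have : pauliDot a * K = K * pauli 2 := by
      ext x i
      change (pauliDot a *ᵥ ket i) x = _
      fin_cases i <;> simp [e0, e1, hK, pauli, Matrix.mul_apply, Fin.sum_univ_two]
    rw [← this, mul_assoc, hKK', mul_one]
  rw [hP, hP, hA, single_zero_eq, single_one_eq]
  constructor
  · rw [Matrix.mul_smul, Matrix.smul_mul, mul_add, add_mul, mul_one, hKK']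
  · rw [Matrix.mul_smul, Matrix.smul_mul, mul_sub, sub_mul, mul_one, hKK']

open Classical in
/-- The sum of the distinct operators among the permutations of `P_0^{⊗ k} ⊗ P_1^{⊗ (N - k)}`. -/
def coarseOp (N k : ℕ) (P : Fin 2 → Matrix (Fin 2) (Fin 2) ℂ) : QubitOp N :=
  ∑ T ∈ Finset.univ.image (fun p : Equiv.Perm (Fin N) =>
      tensorOp fun n : Fin N => P (if (p.symm n : ℕ) < k then 0 else 1)), T

theorem measOp_eq_coarseOp (N k : ℕ) (ket : Fin 2 → Fin 2 → ℂ) :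
    measOp N k ket = coarseOp N k fun i => Matrix.vecMulVec (ket i) (star (ket i)) := by
  rw [measOp, coarseOp]
  congr 2
  funext p
  rw [permOp_mul_tensorOp]
  congr 1
  funext n
  simp only [Function.comp_apply]
  split_ifs <;> rfl

/-- The sum runs over distinct operators, so injectivity of conjugation by U^{⊗N} is needed: it
keeps distinct terms distinct. -/
theorem coarseOp_conj {N k : ℕ} {U : Matrix (Fin 2) (Fin 2) ℂ}
    (hU : U ∈ Matrix.unitaryGroup (Fin 2) ℂ) (P : Fin 2 → Matrix (Fin 2) (Fin 2) ℂ) :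
    coarseOp N k (fun i => U * P i * Uᴴ) =
      tensorOp (fun _ => U) * coarseOp N k P * (tensorOp fun _ => U)ᴴ := by
  classical
  have hUU : (tensorOp fun _ : Fin N => U)ᴴ * tensorOp (fun _ => U) = 1 := by
    rw [tensorOp_conjTranspose, tensorOp_mul, ← tensorOp_one]
    congr 1
    funext n
    exact Matrix.mem_unitaryGroup_iff'.mp hU
  have hinj : Function.Injective fun T : QubitOp N =>
      tensorOp (fun _ => U) * T * (tensorOp fun _ => U)ᴴ := by
    refine Function.LeftInverse.injective
      (g := fun T => (tensorOp fun _ => U)ᴴ * T * tensorOp (fun _ => U)) fun T => ?_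
    dsimp only
    rw [show ∀ V W : QubitOp N, W * (V * T * W) * V = (W * V) * T * (W * V) by
      intro V W; simp only [mul_assoc], hUU, one_mul, mul_one]
  rw [coarseOp, coarseOp, Finset.mul_sum, Finset.sum_mul]
  refine Eq.trans ?_ (Finset.sum_image (f := fun T => T) hinj.injOn)
  rw [Finset.image_image]
  refine Finset.sum_congr ?_ fun _ _ => rfl
  refine congrArg (fun F => Finset.univ.image F) ?_
  funext p
  simp only [Function.comp_apply, tensorOp_conjTranspose, tensorOp_mul]

theorem tensorOp_single {N : ℕ} (y : Fin N → Fin 2) :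
    tensorOp (fun n => Matrix.single (y n) (y n) 1) = Matrix.single y y 1 := by
  ext x x'
  simp only [tensorOp, Matrix.of_apply, Matrix.single_apply, Finset.prod_ite_zero,
    Finset.prod_const_one, Finset.mem_univ, true_implies, funext_iff, forall_and]

theorem ones_threshold {N k : ℕ} (hk : k ≤ N) :
    ones (fun n : Fin N => if (n : ℕ) < k then 0 else 1) + k = N := by
  have h : (Finset.univ.filter fun n : Fin N => (n : ℕ) < k).card = k := by
    simp [Fin.card_filter_val_lt, hk]
  have h' := Finset.card_filter_add_card_filter_not (s := (Finset.univ : Finset (Fin N)))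
    fun n => (n : ℕ) < k
  rw [h, Finset.card_univ, Fintype.card_fin] at h'
  have : ones (fun n : Fin N => if (n : ℕ) < k then 0 else 1) =
      (Finset.univ.filter fun n : Fin N => ¬ (n : ℕ) < k).card := by
    rw [ones]
    congr 1
    ext n
    simp
  omega

/-- The distinct terms are the rank-one projectors onto the product states with k zeros, because
permutations reach every such configuration. -/
theorem coarseOp_single {N k : ℕ} (hk : k ≤ N) :
    coarseOp N k (fun i => Matrix.single i i 1) =
      Matrix.diagonal fun x => if ones x + k = N then 1 else 0 := by
  classical
  have himage : (Finset.univ.image fun p : Equiv.Perm (Fin N) => tensorOp fun n : Fin N =>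
        (Matrix.single (if (p.symm n : ℕ) < k then (0 : Fin 2) else 1)
          (if (p.symm n : ℕ) < k then (0 : Fin 2) else 1) 1 : Matrix (Fin 2) (Fin 2) ℂ)) =
      (Finset.univ.filter fun y : Fin N → Fin 2 => ones y + k = N).image
        fun y => Matrix.single y y 1 := by
    have hF : (fun p : Equiv.Perm (Fin N) => tensorOp fun n : Fin N =>
        (Matrix.single (if (p.symm n : ℕ) < k then (0 : Fin 2) else 1)
          (if (p.symm n : ℕ) < k then (0 : Fin 2) else 1) 1 : Matrix (Fin 2) (Fin 2) ℂ)) =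
        (fun y => Matrix.single y y 1) ∘ fun p : Equiv.Perm (Fin N) =>
          (fun n : Fin N => if (n : ℕ) < k then (0 : Fin 2) else 1) ∘ p.symm := by
      funext p
      exact tensorOp_single _
    rw [hF, ← Finset.image_image]
    congr 1
    ext y
    simp only [Finset.mem_image, Finset.mem_univ, true_and, Finset.mem_filter]
    constructor
    · rintro ⟨p, rfl⟩
      rw [ones_comp_perm, ones_threshold hk]
    · intro hy
      obtain ⟨p, hp⟩ := exists_perm_of_ones_eq
        (Nat.add_right_cancel (hy.trans (ones_threshold hk).symm))
      exact ⟨p.symm, hp.symm⟩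
  rw [coarseOp, himage, Finset.sum_image, Finset.sum_filter]
  · ext x x'
    rw [Matrix.sum_apply, Finset.sum_eq_single x]
    · by_cases hx : x = x'
      · subst hx
        by_cases h : ones x + k = N <;> simp [h]
      · rw [Matrix.diagonal_apply_ne _ hx]
        split_ifs <;> simp [hx]
    · intro y _ hy
      split_ifs <;> simp [hy]
    · simp
  · intro y _ y' _ h
    have := congrFun (congrFun h y) y
    by_contra hne
    simp [Ne.symm hne] at this

/-! ### Rotating the third axis -/

/-- For an involution `X`, the homomorphism `(z, w) ↦ z (1 + X) / 2 + w (1 - X) / 2`. -/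
def involutionHom {n : Type*} [Fintype n] [DecidableEq n] {X : Matrix n n ℂ} (hX : X * X = 1) :
    ℂ × ℂ →ₐ[ℂ] Matrix n n ℂ :=
  AlgHom.ofLinearMap
    ((LinearMap.fst ℂ ℂ ℂ).smulRight ((1 / 2 : ℂ) • (1 + X)) +
      (LinearMap.snd ℂ ℂ ℂ).smulRight ((1 / 2 : ℂ) • (1 - X)))
    (by
      simp
      module)
    (fun z w => by
      simp only [LinearMap.add_apply, LinearMap.smulRight_apply, LinearMap.fst_apply,
        LinearMap.snd_apply, Prod.fst_mul, Prod.snd_mul, add_mul, mul_add, smul_mul_assoc,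
        mul_smul_comm, mul_sub, sub_mul, hX, one_mul, mul_one]
      module)

-- c X is the image of (c, -c) under `involutionHom`, and the exponential on ℂ × ℂ is componentwise.
open scoped Matrix.Norms.Operator in
theorem exp_smul_involution {n : Type*} [Fintype n] [DecidableEq n] {X : Matrix n n ℂ}
    (hX : X * X = 1) (c : ℂ) : NormedSpace.exp (c • X) =
      Complex.exp c • (1 / 2 : ℂ) • (1 + X) + Complex.exp (-c) • (1 / 2 : ℂ) • (1 - X) := by
  have h : involutionHom hX (c, -c) = c • X := by
    change c • (1 / 2 : ℂ) • (1 + X) + (-c) • (1 / 2 : ℂ) • (1 - X) = c • X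
    module
  have hc : Continuous (involutionHom hX) :=
    (involutionHom hX).toLinearMap.continuous_of_finiteDimensional
  rw [← h, Complex.exp_eq_exp_ℂ]
  refine (NormedSpace.map_exp (involutionHom hX) hc (c, -c)).symm.trans ?_
  change (NormedSpace.exp (c, -c)).1 • (1 / 2 : ℂ) • (1 + X) +
    (NormedSpace.exp (c, -c)).2 • (1 / 2 : ℂ) • (1 - X) = _
  rw [Prod.fst_exp, Prod.snd_exp]

theorem qubitRotation_pi {n : Fin 3 → ℝ} (hn : n 0 ^ 2 + n 1 ^ 2 + n 2 ^ 2 = 1) :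
    qubitRotation (fun l => Real.pi * n l) = (-Complex.I) • ∑ l, (n l : ℂ) • pauli l := by
  have hn' : (n 0 : ℂ) ^ 2 + (n 1 : ℂ) ^ 2 + (n 2 : ℂ) ^ 2 = 1 := by exact_mod_cast hn
  have hX : (∑ l, (n l : ℂ) • pauli l) * (∑ l, (n l : ℂ) • pauli l) = 1 := by
    ext i j
    fin_cases i <;> fin_cases j <;>
      simp [Matrix.mul_apply, Fin.sum_univ_three, Fin.sum_univ_two, pauli] <;>
      first
        | ring1
        | linear_combination hn' - (n 1 : ℂ) ^ 2 * Complex.I_sq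
  have hsum : (-Complex.I) • ∑ l, (((Real.pi * n l : ℝ) : ℂ) / 2) • pauli l =
      (-(Real.pi / 2 * Complex.I)) • ∑ l, (n l : ℂ) • pauli l := by
    rw [Finset.smul_sum, Finset.smul_sum]
    refine Finset.sum_congr rfl fun l _ => ?_
    rw [smul_smul, smul_smul]
    congr 1
    push_cast
    ring
  rw [qubitRotation, hsum, exp_smul_involution hX, neg_neg, Complex.exp_neg,
    Complex.exp_pi_div_two_mul_I, Complex.inv_I]
  module

/-- A half turn about a unit vector n is -i n · σ and sends e₃ to 2 n₃ n - e₃. So n has to bisect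
the angle between a and e₃. -/
theorem exists_qubitRotation {a : EuclideanSpace ℝ (Fin 3)} (ha : ‖a‖ = 1) :
    ∃ t : Fin 3 → ℝ, pauliDot a = qubitRotation t * pauli 2 * (qubitRotation t)ᴴ := by
  have ha' : a 0 ^ 2 + a 1 ^ 2 + a 2 ^ 2 = 1 := by
    have := EuclideanSpace.norm_sq_eq a
    rw [ha, Fin.sum_univ_three] at this
    simpa using this.symm
  suffices h : ∃ n : Fin 3 → ℝ, n 0 ^ 2 + n 1 ^ 2 + n 2 ^ 2 = 1 ∧ 2 * n 2 * n 0 = a 0 ∧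
      2 * n 2 * n 1 = a 1 ∧ 2 * n 2 ^ 2 - 1 = a 2 by
    obtain ⟨n, hn, h0, h1, h2⟩ := h
    have hn' : (n 0 : ℂ) ^ 2 + (n 1 : ℂ) ^ 2 + (n 2 : ℂ) ^ 2 = 1 := by exact_mod_cast hn
    refine ⟨fun l => Real.pi * n l, ?_⟩
    rw [qubitRotation_pi hn]
    ext i j
    fin_cases i <;> fin_cases j <;>
      simp [pauliDot, Matrix.mul_apply, Fin.sum_univ_three, Fin.sum_univ_two, pauli, ← h0, ← h1,
        ← h2]
    · linear_combination hn' +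
        ((n 2 : ℂ) ^ 2 - (n 0 : ℂ) ^ 2 + (n 1 : ℂ) ^ 2 * (Complex.I ^ 2 - 1)) * Complex.I_sq
    · linear_combination (2 * n 2 * (n 0 - n 1 * Complex.I)) * Complex.I_sq
    · linear_combination (2 * n 2 * (n 0 + n 1 * Complex.I)) * Complex.I_sq
    · linear_combination -hn' -
        ((n 2 : ℂ) ^ 2 - (n 0 : ℂ) ^ 2 + (n 1 : ℂ) ^ 2 * (Complex.I ^ 2 - 1)) * Complex.I_sq
  by_cases h2 : a 2 = -1
  -- For a = -e₃ there is no bisector a + e₃ to normalize; any horizontal axis works.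
  · refine ⟨![1, 0, 0], ?_⟩
    have h0 : a 0 = 0 := by nlinarith [sq_nonneg (a 0), sq_nonneg (a 1)]
    have h1 : a 1 = 0 := by nlinarith [sq_nonneg (a 0), sq_nonneg (a 1)]
    simp [h0, h1, h2]
  · have hlt : 0 < 1 + a 2 := by
      have : -1 ≤ a 2 := by nlinarith [sq_nonneg (a 0), sq_nonneg (a 1)]
      have := lt_of_le_of_ne this (Ne.symm h2)
      linarith
    have hs : √(2 * (1 + a 2)) ^ 2 = 2 * (1 + a 2) := Real.sq_sqrt (by positivity)
    have hne : √(2 * (1 + a 2)) ≠ 0 := (Real.sqrt_pos.mpr (by positivity)).ne'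
    -- This is (a + e₃) / ‖a + e₃‖, since ‖a + e₃‖² = 2(1 + a₃).
    refine ⟨![a 0 / √(2 * (1 + a 2)), a 1 / √(2 * (1 + a 2)), (1 + a 2) / √(2 * (1 + a 2))], ?_⟩
    simp only [Matrix.cons_val]
    generalize √(2 * (1 + a 2)) = q at hs hne
    refine ⟨?_, ?_, ?_, ?_⟩ <;> field_simp
    · linear_combination ha' - hs
    · linear_combination (-a 0) * hs
    · linear_combination (-a 1) * hs
    · linear_combination -(1 + a 2) * hs

/-- With j = N/2 - s, the equation j - r = k - N/2 reads s + r + k = N. Outside -j ≤ m ≤ j no r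
solves it, which matches the zero block. -/
theorem standardBlock_eq_diagonal (N k : ℕ) (s : Fin (N / 2 + 1)) :
    standardBlock N k (twoJ N s) =
      Matrix.diagonal fun r : Fin (twoJ N s + 1) => if (s : ℕ) + (r : ℕ) + k = N then 1 else 0 := by
  have hm : ∀ r : Fin (twoJ N s + 1),
      (twoJ N s : ℚ) / 2 - (r : ℕ) = (k : ℚ) - (N : ℚ) / 2 ↔ (s : ℕ) + (r : ℕ) + k = N := by
    intro r
    rw [twoJ_cast, ← Nat.cast_inj (R := ℚ)]
    push_cast
    constructor <;> intro h <;> linarith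
  have hket : Matrix.vecMulVec (spinKet (twoJ N s) ((k : ℚ) - (N : ℚ) / 2))
      (star (spinKet (twoJ N s) ((k : ℚ) - (N : ℚ) / 2))) =
      Matrix.diagonal fun r : Fin (twoJ N s + 1) => if (s : ℕ) + (r : ℕ) + k = N then 1 else 0 := by
    ext q r
    simp only [Matrix.vecMulVec_apply, spinKet, Pi.star_apply, hm, Matrix.diagonal_apply]
    by_cases h : q = r
    · subst h
      by_cases hq : (s : ℕ) + (q : ℕ) + k = N <;> simp [hq]
    · have : ¬ ((s : ℕ) + (q : ℕ) + k = N ∧ (s : ℕ) + (r : ℕ) + k = N) := by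
        rintro ⟨h1, h2⟩
        exact h (Fin.ext (by omega))
      by_cases hq : (s : ℕ) + (q : ℕ) + k = N <;> by_cases hr : (s : ℕ) + (r : ℕ) + k = N <;>
        simp_all
  rw [standardBlock]
  split_ifs with h
  · exact hket
  · symm
    rw [Matrix.diagonal_eq_zero]
    funext r
    refine if_neg fun hr => h ?_
    rw [← (hm r).mpr hr]
    have hr' : ((r : ℕ) : ℚ) ≤ twoJ N s := by exact_mod_cast Nat.lt_succ_iff.mp r.2
    have hr'' : (0 : ℚ) ≤ (r : ℕ) := Nat.cast_nonneg _
    constructor <;> linarith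

section

variable {N : ℕ} {κ : Fin (N / 2 + 1) → Type*} [∀ s, Fintype (κ s)] [∀ s, DecidableEq (κ s)]

/-- A spin basis vector with indices s, r is supported on configurations with s + r ones, where the
diagonal operator is constant. -/
theorem hasBlocks_coarseOp_single
    (b : ∀ s : Fin (N / 2 + 1), OrthonormalBasis (κ s) ℂ (multSpace N s)) (k : Fin (N + 1)) :
    HasBlocks (spinBasis b) (coarseOp N k fun i => Matrix.single i i 1)
      fun s => standardBlock N k (twoJ N s) := by
  simp only [standardBlock_eq_diagonal]
  rw [coarseOp_single (Nat.lt_succ_iff.mp k.2)]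
  refine hasBlocks_diagonal fun s r α => ?_
  have hlevel := spinBasis_mem_levelSpace b s r α
  ext x
  rw [opLin_apply, Matrix.mulVec_diagonal, PiLp.smul_apply, smul_eq_mul]
  by_cases hx : ones x = s + r
  · rw [hx]
  · rw [hlevel x hx, mul_zero, mul_zero]

theorem pauliDot_single_two : pauliDot (EuclideanSpace.single 2 1) = pauli 2 := by
  simp [pauliDot]

theorem measOp_eq_coarseOp_single {k : ℕ} {ket : Fin 2 → Fin 2 → ℂ}
    (h : IsLocalBasis (EuclideanSpace.single 2 1) ket) :
    measOp N k ket = coarseOp N k fun i => Matrix.single i i 1 := by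
  obtain ⟨h0, h1⟩ := vecMulVec_eq_of_isLocalBasis h
  rw [pauliDot_single_two] at h0 h1
  rw [measOp_eq_coarseOp]
  congr 1
  funext i
  fin_cases i
  · exact h0.trans single_zero_eq.symm
  · exact h1.trans single_one_eq.symm

theorem measOp_eq_conj {k : ℕ} {ket : Fin 2 → Fin 2 → ℂ} {a : EuclideanSpace ℝ (Fin 3)}
    {U : Matrix (Fin 2) (Fin 2) ℂ} (hU : U ∈ Matrix.unitaryGroup (Fin 2) ℂ)
    (ha : pauliDot a = U * pauli 2 * Uᴴ) (h : IsLocalBasis a ket) :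
    measOp N k ket = tensorOp (fun _ => U) * coarseOp N k (fun i => Matrix.single i i 1) *
      (tensorOp fun _ => U)ᴴ := by
  obtain ⟨h0, h1⟩ := vecMulVec_eq_of_isLocalBasis h
  have hUU : U * Uᴴ = 1 := Matrix.mem_unitaryGroup_iff.mp hU
  rw [← coarseOp_conj hU, measOp_eq_coarseOp]
  congr 1
  funext i
  fin_cases i
  · refine h0.trans ?_
    dsimp only [Fin.zero_eta]
    rw [single_zero_eq, ha, Matrix.mul_smul, Matrix.smul_mul, mul_add, add_mul, mul_one, hUU]
  · refine h1.trans ?_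
    dsimp only [Fin.mk_one]
    rw [single_one_eq, ha, Matrix.mul_smul, Matrix.smul_mul, mul_sub, sub_mul, mul_one, hUU]

end

end

theorem proposition2 (N : ℕ) (κ : Fin (N / 2 + 1) → Type*) [∀ s, Fintype (κ s)]
    [∀ s, DecidableEq (κ s)]
    (b : ∀ s : Fin (N / 2 + 1), OrthonormalBasis (κ s) ℂ (multSpace N s)) :
    (∀ s, Nonempty (κ s)) ∧
    ∃ B : OrthonormalBasis (SpinIndex N κ) ℂ (Qubits N),
      -- `B` consists of the vectors `|j, j - r, α⟩`, where `|j, j, α⟩ = b s α`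
      (∀ (s : Fin (N / 2 + 1)) (r : Fin (twoJ N s + 1)) (α : κ s),
        B ⟨s, (r, α)⟩ = lowered (b s α : Qubits N) r) ∧
      -- the spin-`j` block of `U^{⊗ N}` is `W_j(U)`, which is unitary
      (∀ t : Fin 3 → ℝ,
        (∀ s, spinRotation (twoJ N s) t ∈ Matrix.unitaryGroup (Fin (twoJ N s + 1)) ℂ) ∧
        HasBlocks B (tensorOp fun _ => qubitRotation t)
          (fun s => spinRotation (twoJ N s) t)) ∧
      -- the measurement in the standard basis
      (∀ (k : Fin (N + 1)) (ket : Fin 2 → Fin 2 → ℂ),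
        IsLocalBasis (EuclideanSpace.single 2 1) ket →
        HasBlocks B (measOp N k ket) (fun s => standardBlock N k (twoJ N s))) ∧
      -- the measurement for an arbitrary setting
      (∀ a : EuclideanSpace ℝ (Fin 3), ‖a‖ = 1 →
        (∃ t : Fin 3 → ℝ,
          pauliDot a = qubitRotation t * pauli 2 * (qubitRotation t)ᴴ) ∧
        ∀ t : Fin 3 → ℝ,
          pauliDot a = qubitRotation t * pauli 2 * (qubitRotation t)ᴴ →
          ∀ (k : Fin (N + 1)) (ket : Fin 2 → Fin 2 → ℂ), IsLocalBasis a ket →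
            HasBlocks B (measOp N k ket) (fun s =>
              spinRotation (twoJ N s) t * standardBlock N k (twoJ N s) *
                (spinRotation (twoJ N s) t)ᴴ)) := by
  refine ⟨fun s => nonempty_of_basis_multSpace (b s), spinBasis b,
    fun s r α => spinBasis_apply b ⟨s, (r, α)⟩,
    fun t => ⟨fun s => spinRotation_mem_unitaryGroup _ t, hasBlocks_rotation b t⟩,
    fun k ket hket => ?_, fun a ha => ⟨exists_qubitRotation ha, fun t ht k ket hket => ?_⟩⟩
  · rw [measOp_eq_coarseOp_single hket]
    exact hasBlocks_coarseOp_single b k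
  · rw [measOp_eq_conj (qubitRotation_mem_unitaryGroup t) ht hket]
    exact ((hasBlocks_rotation b t).mul (hasBlocks_coarseOp_single b k)).mul
      (hasBlocks_rotation b t).conjTranspose
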